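/- Let $\mathbb{F}_q$ be a finite field with $q$ elements and let $\overline{\mathbb{F}_q(T)}$ be an algebraic closure of the rational function field $\mathbb{F}_q(T)$. An element $\alpha\in\overline{\mathbb{F}_q(T)}$ is called constant if it is algebraic over $\mathbb{F}_q$, and totally $T$-adic if its minimal polynomial over $\mathbb{F}_q(T)$ splits into linear factors over the field of formal Laurent series $\mathbb{F}_q((T))$. Its height is $h(\alpha)=\deg_T(f)/\deg_x(f)$, where $f\in\mathbb{F}_q[T][x]$ is the minimal polynomial of $\alpha$, that is, the polynomial with $f(\alpha)=0$ that is irreducible in $\mathbb{F}_q(T)[x]$, whose coefficients have no common factor in $\mathbb{F}_q[T]$, and whose leading coefficient is monic. The gonality of a smooth proper curve over $\mathbb{F}_q$ is the minimal degree of a nonconstant $\mathbb{F}_q$-morphism from it to $\mathbb{P}^1_{\mathbb{F}_q}$. **Theorem.** Let $\alpha\in\overline{\mathbb{F}_q(T)}$ be nonconstant and totally $T$-adic, of degree $d=[\mathbb{F}_q(T)(\alpha):\mathbb{F}_q(T)]$ and of height $h(\alpha)=\frac{1}{q+1}$, and let $C_\alpha$ be the smooth proper curve over $\mathbb{F}_q$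 whose function field is $\mathbb{F}_q(T)(\alpha)$. Then $$\#C_\alpha(\mathbb{F}_q)=d=n(q+1),$$ where $n$ is the gonality of $C_\alpha$. Moreover, $n$ is equal to the number of conjugates $\beta\in\mathbb{F}_q((T))$ of $\alpha$ (that is, roots of its minimal polynomial) whose $T$-adic valuation is positive. -/

import Mathlib

open Polynomial AlgebraicGeometry CategoryTheory

universe u

namespace TAdic

/-! ### Algebraic functions -/

section AlgebraicFunctions

variable {F : Type u} [Field F]

open scoped RatFunc in
/-- The inclusion of `F(T)` into its `T`-adic completion, the field `F((T))` of formal Laurent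
series. It extends the inclusion of `F[T]`, and sends `T` to `T` (see `toLaurent_X`). -/
noncomputable def toLaurent (F : Type u) [Field F] : RatFunc F →+* LaurentSeries F :=
  algebraMap (RatFunc F) (LaurentSeries F)

theorem toLaurent_X : toLaurent F RatFunc.X = HahnSeries.single 1 1 :=
  RatFunc.coe_X

/-- `α` is totally `T`-adic: its minimal polynomial over `F(T)` splits into linear factors over
the field `F((T))` of formal Laurent series. -/
def IsTotallyTAdic (α : AlgebraicClosure (RatFunc F)) : Prop :=
  ((minpoly (RatFunc F) α).map (toLaurent F)).Splits

/-- The defining properties of the minimal polynomial `f ∈ F[T][x]` of `α`: it is irreducible as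
a polynomial in `x` over `F(T)`, it vanishes at `α`, its coefficients have no common factor in
`F[T]`, and its leading coefficient (an element of `F[T]`) is monic. -/
structure IsIntegralMinpoly (α : AlgebraicClosure (RatFunc F)) (f : F[X][X]) : Prop where
  irreducible : Irreducible (f.map (algebraMap F[X] (RatFunc F)))
  aeval_eq_zero : aeval α (f.map (algebraMap F[X] (RatFunc F))) = 0
  isPrimitive : f.IsPrimitive
  monic_leadingCoeff : f.leadingCoeff.Monic

/-- Every `α` has a minimal polynomial in `F[T][x]`. -/
theorem exists_isIntegralMinpoly (α : AlgebraicClosure (RatFunc F)) :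
    ∃ f : F[X][X], IsIntegralMinpoly α f := by
  classical
  let : NormalizedGCDMonoid F[X] := Nonempty.some inferInstance
  set m := minpoly (RatFunc F) α with hm
  have hint : IsIntegral (RatFunc F) α := Algebra.IsIntegral.isIntegral α
  have hirr : Irreducible m := minpoly.irreducible hint
  obtain ⟨b, hb, hg⟩ := IsLocalization.integerNormalization_spec (nonZeroDivisors F[X]) m
  set g := IsLocalization.integerNormalization (nonZeroDivisors F[X]) m with hgdef
  have hinj : Function.Injective (algebraMap F[X] (RatFunc F)) := IsFractionRing.injective _ _
  have hg0 : g ≠ 0 := by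
    rw [hgdef, Ne, IsFractionRing.integerNormalization_eq_zero_iff]
    exact hirr.ne_zero
  set p := g.primPart with hp
  have hp0 : p ≠ 0 := g.isPrimitive_primPart.ne_zero
  set c : F := p.leadingCoeff.leadingCoeff with hc
  have hc0 : c ≠ 0 := by simpa [hc] using hp0
  have hunit : IsUnit (C (C c⁻¹) : F[X][X]) := by
    rw [Polynomial.isUnit_C, Polynomial.isUnit_C]
    exact (inv_ne_zero hc0).isUnit
  have hassoc : Associated (C (C c⁻¹) * p) p := (associated_unit_mul_left p _ hunit)
  have hcont : algebraMap F[X] (RatFunc F) g.content ≠ 0 := by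
    rw [Ne, map_eq_zero_iff _ hinj, content_eq_zero_iff]
    exact hg0
  have hbne : algebraMap F[X] (RatFunc F) b ≠ 0 := by
    rw [Ne, map_eq_zero_iff _ hinj]
    exact nonZeroDivisors.ne_zero hb
  have hgm : g.map (algebraMap F[X] (RatFunc F)) = C (algebraMap F[X] (RatFunc F) b) * m := by
    rw [hg, Algebra.smul_def]
    rfl
  have hpm : C (algebraMap F[X] (RatFunc F) g.content) * p.map (algebraMap F[X] (RatFunc F)) =
      C (algebraMap F[X] (RatFunc F) b) * m := by
    rw [← hgm]
    conv_rhs => rw [g.eq_C_content_mul_primPart]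
    rw [Polynomial.map_mul, map_C]
  have hass2 : Associated (p.map (algebraMap F[X] (RatFunc F))) m := by
    have h1 := associated_unit_mul_left (p.map (algebraMap F[X] (RatFunc F)))
      (C (algebraMap F[X] (RatFunc F) g.content)) (isUnit_C.2 hcont.isUnit)
    have h2 := associated_unit_mul_left m
      (C (algebraMap F[X] (RatFunc F) b)) (isUnit_C.2 hbne.isUnit)
    rw [hpm] at h1
    exact h1.symm.trans h2
  have hass3 : Associated ((C (C c⁻¹) * p).map (algebraMap F[X] (RatFunc F))) m :=
    (hassoc.map (mapRingHom (algebraMap F[X] (RatFunc F)))).trans hass2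
  refine ⟨C (C c⁻¹) * p, hass3.symm.irreducible hirr, ?_, ?_, ?_⟩
  · obtain ⟨r, hr⟩ := hass3.symm.dvd
    rw [hr, map_mul, hm, minpoly.aeval, zero_mul]
  · exact isPrimitive_of_dvd g.isPrimitive_primPart hassoc.dvd
  · rw [leadingCoeff_mul, leadingCoeff_C, Monic, leadingCoeff_mul, leadingCoeff_C]
    exact inv_mul_cancel₀ hc0

/-- The minimal polynomial of `α` in `F[T][x]` is unique. -/
theorem IsIntegralMinpoly.unique {α : AlgebraicClosure (RatFunc F)} {f g : F[X][X]}
    (hf : IsIntegralMinpoly α f) (hg : IsIntegralMinpoly α g) : f = g := by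
  let : NormalizedGCDMonoid F[X] := Nonempty.some inferInstance
  have key : ∀ {f g : F[X][X]}, IsIntegralMinpoly α f → IsIntegralMinpoly α g → f ∣ g := by
    intro f g hf hg
    refine hf.isPrimitive.dvd_of_fraction_map_dvd_fraction_map (K := RatFunc F) ?_
    have h1 := minpoly.dvd _ _ hf.aeval_eq_zero
    have h2 := minpoly.dvd _ _ hg.aeval_eq_zero
    have hn := minpoly.not_isUnit (RatFunc F) α
    exact ((hf.irreducible.dvd_iff.1 h1).resolve_left hn).dvd.trans h2
  obtain ⟨v, hv⟩ := associated_of_dvd_dvd (key hf hg) (key hg hf)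
  obtain ⟨w, hw, hwv⟩ := Polynomial.isUnit_iff.1 v.isUnit
  obtain ⟨c, hc, hcw⟩ := Polynomial.isUnit_iff.1 hw
  have h3 : g.leadingCoeff = f.leadingCoeff * C c := by
    rw [← hv, ← hwv, ← hcw, leadingCoeff_mul, leadingCoeff_C]
  have h4 := congrArg leadingCoeff h3
  rw [hg.monic_leadingCoeff.leadingCoeff, leadingCoeff_mul, leadingCoeff_C,
    hf.monic_leadingCoeff.leadingCoeff, one_mul] at h4
  rw [← hv, ← hwv, ← hcw, ← h4, C_1, C_1, mul_one]

/-- The minimal polynomial of `α` in `F[T][x]`. -/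
noncomputable def integralMinpoly (α : AlgebraicClosure (RatFunc F)) : F[X][X] :=
  (exists_isIntegralMinpoly α).choose

theorem isIntegralMinpoly_integralMinpoly (α : AlgebraicClosure (RatFunc F)) :
    IsIntegralMinpoly α (integralMinpoly α) :=
  (exists_isIntegralMinpoly α).choose_spec

/-- The degree in `T` of a polynomial `f ∈ F[T][x]`. -/
noncomputable def degreeT (f : F[X][X]) : ℕ :=
  f.support.sup fun i => (f.coeff i).natDegree

/-- The (absolute logarithmic Weil) height `h(α) = deg_T(f) / deg_x(f)`, where `f ∈ F[T][x]` is
the minimal polynomial of `α`. -/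
noncomputable def height (α : AlgebraicClosure (RatFunc F)) : ℝ :=
  (degreeT (integralMinpoly α) : ℝ) / ((integralMinpoly α).natDegree : ℝ)

/-- The conjugates of `α` in `F((T))` (the roots there of its minimal polynomial over `F(T)`)
that have positive `T`-adic valuation. `HahnSeries.orderTop` is the `T`-adic valuation, with
value `⊤` at `0`. -/
def positiveConjugates (α : AlgebraicClosure (RatFunc F)) : Set (LaurentSeries F) :=
  {β | (minpoly (RatFunc F) α).eval₂ (toLaurent F) β = 0 ∧ 0 < HahnSeries.orderTop β}

end AlgebraicFunctions

/-! ### Curves -/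

section Curves

variable {F : Type u} [Field F]

/-- The `F`-rational points of an `F`-scheme: the sections of its structure morphism. -/
def RationalPoints {C : Scheme.{u}} (s : C ⟶ Spec (CommRingCat.of F)) : Type u :=
  {p : Spec (CommRingCat.of F) ⟶ C // p ≫ s = 𝟙 (Spec (CommRingCat.of F))}

/-- The inclusion of the constants `F` into the function field of an irreducible `F`-scheme:
`F → Γ(C, ⊤) → F(C)`, where the second map takes the germ at the generic point. -/
noncomputable def constants {C : Scheme.{u}} [IrreducibleSpace C]
    (s : C ⟶ Spec (CommRingCat.of F)) : F →+* C.functionField :=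
  ((Scheme.ΓSpecIso (CommRingCat.of F)).inv ≫ s.appTop ≫
    C.presheaf.germ ⊤ (genericPoint C) trivial).hom

attribute [local instance] MvPolynomial.gradedAlgebra

/-- The projective line `Proj F[X₀, X₁]` over `F`. -/
noncomputable def ProjectiveLine (F : Type u) [Field F] : Scheme.{u} :=
  Proj (MvPolynomial.homogeneousSubmodule (Fin 2) F)

/-- The structure morphism of the projective line, given by `F → F[X₀, X₁]₀`. -/
noncomputable def ProjectiveLine.toSpec (F : Type u) [Field F] :
    ProjectiveLine F ⟶ Spec (CommRingCat.of F) :=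
  Proj.toSpecZero (MvPolynomial.homogeneousSubmodule (Fin 2) F) ≫
    Spec.map (CommRingCat.ofHom
      (algebraMap F (MvPolynomial.homogeneousSubmodule (Fin 2) F 0)))

/-- A morphism of schemes is nonconstant if it does not send all points to a single point. -/
def IsNonconstant {X Y : Scheme.{u}} (φ : X ⟶ Y) : Prop :=
  ∃ x y : X, φ x ≠ φ y

/-- The degree of a nonconstant morphism of curves `φ : X ⟶ Y`: the degree of the extension of
function fields. Here `η` is the generic point of `X`; since `φ` is nonconstant, `φ η` is the
generic point of `Y`, so the local ring of `Y` at `φ η` is the function field of `Y`. -/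
noncomputable def degree {X Y : Scheme.{u}} [IrreducibleSpace X] (φ : X ⟶ Y) : ℕ :=
  letI := (φ.stalkMap (genericPoint X)).hom.toAlgebra
  Module.finrank (Y.presheaf.stalk (φ (genericPoint X))) X.functionField

/-- The gonality of a curve over `F`: the minimal degree of a nonconstant `F`-morphism to the
projective line. -/
noncomputable def gonality {C : Scheme.{u}} [IrreducibleSpace C]
    (s : C ⟶ Spec (CommRingCat.of F)) : ℕ :=
  sInf {n | ∃ φ : C ⟶ ProjectiveLine F,
    φ ≫ ProjectiveLine.toSpec F = s ∧ IsNonconstant φ ∧ degree φ = n}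

end Curves

end TAdic

/-! Let K = F(T)(α), let q be the order of F, let f in F[T][x] be the minimal polynomial of α and d
its degree in x. The theorem comes from counting the rational places of K in two ways and finding
that the two bounds meet.

Lower bound: since α is totally T-adic, its d conjugates lie in F((T)). They are distinct, because F
is perfect and elements of F((T)) algebraic over F(T) are separable
(`separable_of_irreducible_of_eval₂_eq_zero`). So K has d embeddings into F((T)) over F(T). Each
pulls F[[T]] back to a rational place, and distinct embeddings give distinct places
(`laurentPlace_injective`).

Upper bound: a function θ takes each of the q + 1 values in F ∪ {∞} at no more than [K : F(θ)]
rational places (`card_le_finrank_of_valuation_lt_one`, by weak approximation). For θ = α this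
degree is at most deg_T f (`finiteDimensional_adjoin_and_finrank_le`), and the height hypothesis
says exactly that d = (q + 1) deg_T f. Hence d ≤ #places ≤ [K : F(α)] (q + 1) ≤ (q + 1) deg_T f = d,
and equality holds throughout. In particular every fibre of α over F ∪ {∞} is full. The fibre over 0
consists of the embeddings that send α to a series of positive order, which are the positive
conjugates.

Gonality: any nonconstant morphism of degree m to the projective line satisfies d ≤ m (q + 1) by the
same upper bound, and α attains equality.

The rest is a translation between schemes and fields. Local rings of a smooth curve are valuation
rings (`valuationRing_stalk`); by the valuative criterion, rational points correspond to rational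
places (`card_rationalPoints`); nonconstant morphisms to the projective line yield transcendental
functions of the same degree, and conversely when there is a rational point
(`exists_transcendental_degree_eq`, `exists_isNonconstant_degree_eq`). -/

namespace TAdic

/-! ### Rational places of a function field, and the bound on the fibres of a function. -/

section RationalPlaces

variable {F K : Type*} [Field F] [Field K] [Algebra F K]

/-- A valuation ring of `K` is a rational place of `K/F` if it contains `F` and if its residue
field is `F`. -/
structure IsRationalPlace (F : Type*) {K : Type*} [Field F] [Field K] [Algebra F K]
    (O : ValuationSubring K) : Prop where
  algebraMap_mem : ∀ c : F, algebraMap F K c ∈ O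
  exists_residue : ∀ x ∈ O, ∃ c : F, O.valuation (x - algebraMap F K c) < 1

namespace IsRationalPlace

variable {O O' : ValuationSubring K}

theorem valuation_algebraMap_le (hO : IsRationalPlace F O) (c : F) :
    O.valuation (algebraMap F K c) ≤ 1 :=
  (O.valuation_le_one_iff _).2 (hO.algebraMap_mem c)

theorem valuation_algebraMap (hO : IsRationalPlace F O) {c : F} (hc : c ≠ 0) :
    O.valuation (algebraMap F K c) = 1 := by
  refine le_antisymm (hO.valuation_algebraMap_le c) ?_
  have h := hO.valuation_algebraMap_le c⁻¹
  rw [map_inv₀, map_inv₀] at h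
  refine (inv_le_one₀ ?_).1 h
  rw [zero_lt_iff]
  simpa using hc

theorem residue_unique (hO : IsRationalPlace F O) {x : K} {a b : F}
    (ha : O.valuation (x - algebraMap F K a) < 1) (hb : O.valuation (x - algebraMap F K b) < 1) :
    a = b := by
  by_contra h
  have h1 := O.valuation.map_sub_lt ha hb
  rw [sub_sub_sub_cancel_left, ← map_sub, hO.valuation_algebraMap (sub_ne_zero.2 (Ne.symm h))] at h1
  exact h1.false

/-- If x lies in O' but not in O, then x⁻¹ vanishes at O and has some residue c at O'. The maximal
ideal of O' lies in that of O, so c is also its residue at O, whence c = 0. Then x⁻¹ vanishes at O',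
contradicting x ∈ O'. -/
theorem eq_of_le (hO : IsRationalPlace F O) (hO' : IsRationalPlace F O') (h : O ≤ O') :
    O = O' := by
  refine le_antisymm h fun x hx => ?_
  by_contra hxO
  have hx0 : x ≠ 0 := fun h0 => hxO (h0 ▸ O.zero_mem)
  have hxi : x⁻¹ ∈ O := (O.mem_or_inv_mem x).resolve_left hxO
  obtain ⟨c, hc⟩ := hO'.exists_residue _ (h hxi)
  have mono : ∀ y : K, O'.valuation y < 1 → O.valuation y < 1 := by
    intro y hy
    by_contra hy'
    have hy0 : y ≠ 0 := by
      rintro rfl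
      simp at hy'
    have h1 : y⁻¹ ∈ O := by
      rw [← O.valuation_le_one_iff, map_inv₀]
      exact inv_le_one_of_one_le₀ (not_lt.1 hy')
    have h2 := (O'.valuation_le_one_iff _).2 (h h1)
    rw [map_inv₀] at h2
    exact absurd ((inv_le_one₀ (by rw [zero_lt_iff]; simpa using hy0)).1 h2) (not_le.2 hy)
  have hxl : O.valuation x⁻¹ < 1 := by
    rw [map_inv₀]
    exact inv_lt_one_of_one_lt₀ (not_le.1 fun h' => hxO ((O.valuation_le_one_iff _).1 h'))
  have hc0 : c = 0 := hO.residue_unique (mono _ hc) (by simpa using hxl)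
  rw [hc0, map_zero, sub_zero, map_inv₀] at hc
  have h3 := (O'.valuation_le_one_iff _).2 hx
  exact absurd ((one_le_inv₀ (by rw [zero_lt_iff]; simpa using hx0)).2 h3) (not_le.2 hc)

variable [Fintype F]

/-- An element of `K` that is congruent to `1` at every rational place containing `w` and vanishes
at the other ones. -/
noncomputable def indicator (F : Type*) {K : Type*} [Field F] [Field K] [Algebra F K] [Fintype F]
    (w : K) : K :=
  (w ^ Fintype.card F - w + 1)⁻¹

/-- The residue c of w lies in F, so c ^ q = c and w ^ q - w vanishes at O. -/
theorem valuation_indicator_sub_one (hO : IsRationalPlace F O) {w : K} (hw : w ∈ O) :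
    O.valuation (indicator F w - 1) < 1 := by
  obtain ⟨c, hc⟩ := hO.exists_residue w hw
  set y := w - algebraMap F K c with hy
  have h1 : w ^ Fintype.card F - w = y ^ Fintype.card F - y := by
    have h := map_sub (FiniteField.frobeniusAlgHom F K) w (algebraMap F K c)
    rw [AlgHom.commutes] at h
    simp only [FiniteField.coe_frobeniusAlgHom] at h
    rw [hy, h]
    ring
  have h2 : O.valuation (w ^ Fintype.card F - w) < 1 := by
    rw [h1]
    refine O.valuation.map_sub_lt ?_ hc
    rw [map_pow]
    exact pow_lt_one₀ zero_le hc Fintype.card_ne_zero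
  set d := w ^ Fintype.card F - w
  have h3 : O.valuation (d + 1) = 1 := by
    rw [add_comm, O.valuation.map_add_eq_of_lt_left (by simpa using h2), map_one]
  have h4 : d + 1 ≠ 0 := by
    intro h
    simp [h] at h3
  have h5 : indicator F w - 1 = - d / (d + 1) := by
    rw [indicator, eq_div_iff h4, sub_mul, inv_mul_cancel₀ h4]
    ring
  rw [h5, map_div₀, h3, Valuation.map_neg, div_one]
  exact h2

/-- At a pole of w the term w ^ q dominates the denominator, so the inverse vanishes. -/
theorem valuation_indicator (O : ValuationSubring K) {w : K} (hw : w ∉ O) :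
    O.valuation (indicator F w) < 1 := by
  have h1 : 1 < O.valuation w := not_le.1 fun h => hw ((O.valuation_le_one_iff _).1 h)
  have hlt : O.valuation w < O.valuation w ^ Fintype.card F :=
    lt_self_pow₀ h1 Fintype.one_lt_card
  have h2 : O.valuation (w ^ Fintype.card F + (1 - w)) = O.valuation w ^ Fintype.card F := by
    rw [← map_pow]
    refine O.valuation.map_add_eq_of_lt_left ?_
    rw [map_pow]
    exact O.valuation.map_sub_lt (by simpa using h1.trans hlt) hlt
  rw [indicator, map_inv₀, show w ^ Fintype.card F - w + 1 = w ^ Fintype.card F + (1 - w) by ring,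
    h2]
  exact inv_lt_one_of_one_lt₀ (h1.trans hlt)

/-- Weak approximation for rational places. -/
theorem exists_approx (S : Finset (ValuationSubring K)) (hS : ∀ O ∈ S, IsRationalPlace F O) :
    ∃ y : ValuationSubring K → K, ∀ O ∈ S, O.valuation (y O - 1) < 1 ∧
      ∀ O' ∈ S, O' ≠ O → O'.valuation (y O) < 1 := by
  classical
  have hw : ∀ O O' : ValuationSubring K, ∃ w : K, O ∈ S → O' ∈ S → O' ≠ O → w ∈ O ∧ w ∉ O' := by
    intro O O'
    by_cases h : O ∈ S ∧ O' ∈ S ∧ O' ≠ O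
    · have : ¬ O ≤ O' := fun hle => h.2.2 ((hS O h.1).eq_of_le (hS O' h.2.1) hle).symm
      obtain ⟨w, hw⟩ := SetLike.not_le_iff_exists.1 this
      exact ⟨w, fun _ _ _ => hw⟩
    · exact ⟨0, fun h1 h2 h3 => absurd ⟨h1, h2, h3⟩ h⟩
  choose w hw using hw
  have hmul : ∀ (O : ValuationSubring K) (a b : K), O.valuation (a - 1) < 1 →
      O.valuation (b - 1) < 1 → O.valuation (a * b - 1) < 1 := by
    intro O a b ha hb
    have h1 : a * b - 1 = (a - 1) * (b - 1) + ((a - 1) + (b - 1)) := by ring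
    rw [h1]
    refine O.valuation.map_add_lt ?_ (O.valuation.map_add_lt ha hb)
    rw [map_mul]
    exact mul_lt_one_of_lt_of_le ha hb.le
  -- Since `w O O'` is regular at O with a pole at O', its indicator is congruent to 1 at O and
  -- vanishes at O'. Indicators are integral at every rational place, so the other factors do no
  -- harm.
  refine ⟨fun O => ∏ O' ∈ S.erase O, indicator F (w O O'), fun O hO => ⟨?_, ?_⟩⟩
  · refine Finset.prod_induction _ (fun a => O.valuation (a - 1) < 1) (hmul O) (by simp) ?_
    intro O' hO'
    rw [Finset.mem_erase] at hO'
    exact (hS O hO).valuation_indicator_sub_one (hw O O' hO hO'.2 hO'.1).1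
  · intro O' hO' hne
    beta_reduce
    rw [← Finset.mul_prod_erase _ _ (Finset.mem_erase.2 ⟨hne, hO'⟩), map_mul]
    refine mul_lt_one_of_lt_of_le (valuation_indicator O' (hw O O' hO hO' hne).2) ?_
    rw [map_prod]
    refine Finset.prod_le_one' fun O'' hO'' => ?_
    simp only [Finset.mem_erase] at hO''
    by_cases hmem : w O O'' ∈ O'
    · have h1 := (hS O' hO').valuation_indicator_sub_one hmem
      have h2 := O'.valuation.map_add_le h1.le O'.valuation.map_one.le
      rwa [sub_add_cancel] at h2
    · exact (valuation_indicator O' hmem).le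

end IsRationalPlace

theorem valuation_aeval_le {O : ValuationSubring K} (hO : IsRationalPlace F O) {u : K}
    (hu : u ∈ O) (p : F[X]) : O.valuation (aeval u p) ≤ 1 := by
  rw [O.valuation_le_one_iff, aeval_eq_sum_range]
  refine sum_mem fun i _ => ?_
  rw [Algebra.smul_def]
  exact mul_mem (hO.algebraMap_mem _) (pow_mem hu i)

/-- Write p = X ^ m * q with q(0) ≠ 0: then q(u) is congruent to the nonzero constant q(0), hence is
a unit at O. -/
theorem valuation_aeval {O : ValuationSubring K} (hO : IsRationalPlace F O) {u : K}
    (hu : O.valuation u < 1) {p : F[X]} (hp : p ≠ 0) :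
    O.valuation (aeval u p) = O.valuation u ^ p.rootMultiplicity 0 := by
  obtain ⟨q, hq, hdvd⟩ := p.exists_eq_pow_rootMultiplicity_mul_and_not_dvd hp 0
  rw [C_0, sub_zero] at hq hdvd
  rw [X_dvd_iff] at hdvd
  have h1 : O.valuation (aeval u q) = 1 := by
    conv_lhs => rw [← divX_mul_X_add q]
    rw [map_add, map_mul, aeval_X, aeval_C, add_comm, O.valuation.map_add_eq_of_lt_left,
      hO.valuation_algebraMap hdvd]
    rw [hO.valuation_algebraMap hdvd, map_mul, mul_comm]
    exact mul_lt_one_of_lt_of_le hu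
      (valuation_aeval_le hO ((O.valuation_le_one_iff _).1 hu.le) _)
  conv_lhs => rw [hq]
  rw [map_mul, map_pow, aeval_X, map_mul, h1, mul_one, map_pow]

open scoped IntermediateField in
-- The approximating functions `y O` are linearly independent over F(u). In a relation with
-- coefficients in F[u], take the place O whose coefficient has the lowest order of vanishing at u =
-- 0: at O its term strictly dominates all others.
theorem card_le_finrank_of_valuation_lt_one [Fintype F] {u : K} (hu0 : u ≠ 0)
    [FiniteDimensional F⟮u⟯ K] (S : Finset (ValuationSubring K))
    (hS : ∀ O ∈ S, IsRationalPlace F O) (hu : ∀ O ∈ S, O.valuation u < 1) :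
    S.card ≤ Module.finrank F⟮u⟯ K := by
  classical
  obtain ⟨y, hy⟩ := IsRationalPlace.exists_approx S hS
  have hy1 : ∀ O ∈ S, O.valuation (y O) = 1 := by
    intro O hO
    have h := O.valuation.map_add_eq_of_lt_left (x := 1) (y := y O - 1)
      (by simpa using (hy O hO).1)
    simpa using h
  have key : ∀ p : S → F[X], ∑ O, aeval u (p O) * y O = 0 → ∀ O, p O = 0 := by
    intro p hp
    by_contra! hne
    obtain ⟨O₁, hO₁⟩ := hne
    obtain ⟨O, hO, hmin⟩ := Finset.exists_min_image (Finset.univ.filter fun O => p O ≠ 0)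
      (fun O => (p O).rootMultiplicity 0) ⟨O₁, by simpa using hO₁⟩
    simp only [Finset.mem_filter, Finset.mem_univ, true_and] at hO hmin
    have hvu : O.1.valuation u < 1 := hu O O.2
    have hvu0 : 0 < O.1.valuation u := by
      rw [zero_lt_iff]
      simpa using hu0
    rw [← Finset.add_sum_erase _ _ (Finset.mem_univ O)] at hp
    have h1 : O.1.valuation (aeval u (p O) * y O) =
        O.1.valuation u ^ (p O).rootMultiplicity 0 := by
      rw [map_mul, hy1 O O.2, mul_one, valuation_aeval (hS O O.2) hvu hO]
    have h2 : O.1.valuation (∑ O' ∈ Finset.univ.erase O, aeval u (p O') * y O') <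
        O.1.valuation u ^ (p O).rootMultiplicity 0 := by
      refine Valuation.map_sum_lt _ (pow_pos hvu0 _).ne' fun O' hO' => ?_
      rw [Finset.mem_erase] at hO'
      by_cases hp' : p O' = 0
      · rw [hp', map_zero, zero_mul, map_zero]
        exact pow_pos hvu0 _
      · have h3 : O.1.valuation (y O') < 1 :=
          (hy O' O'.2).2 O O.2 fun h => hO'.1 (Subtype.ext h.symm)
        rw [map_mul, valuation_aeval (hS O O.2) hvu hp']
        refine (mul_lt_of_lt_one_right (pow_pos hvu0 _) h3).trans_le ?_
        exact pow_le_pow_right_of_le_one' hvu.le (hmin O' hp')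
    have h4 := O.1.valuation.map_add_eq_of_lt_left (h2.trans_eq h1.symm)
    rw [hp, map_zero, h1] at h4
    exact (pow_pos hvu0 _).ne h4
  have hli : LinearIndependent F⟮u⟯ (fun O : S => y O) := by
    rw [Fintype.linearIndependent_iff]
    intro g hg
    have hg' : ∀ O, ∃ r s : F[X], aeval u s ≠ 0 ∧ (g O : K) = aeval u r / aeval u s := by
      intro O
      obtain ⟨r, s, hrs⟩ := (IntermediateField.mem_adjoin_simple_iff F _).1 (g O).2
      by_cases hs : aeval u s = 0
      · exact ⟨0, 1, by simp, by rw [hrs, hs]; simp⟩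
      · exact ⟨r, s, hs, hrs⟩
    choose r s hs hrs using hg'
    -- Multiplying by all the denominators reduces to coefficients in F[u].
    have h0 : ∀ O, aeval u (r O * ∏ O' ∈ Finset.univ.erase O, s O') =
        (∏ O', aeval u (s O')) * g O := by
      intro O
      rw [map_mul, map_prod, hrs, ← Finset.mul_prod_erase _ _ (Finset.mem_univ O)]
      field_simp [hs O]
    have h1 := key (fun O => r O * ∏ O' ∈ Finset.univ.erase O, s O') (by
      simp only [h0, mul_assoc, ← Finset.mul_sum]
      have h2 : ∑ O, (g O : K) * y O = 0 := hg
      rw [h2, mul_zero])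
    intro O
    have h2 := h0 O
    rw [h1 O, map_zero] at h2
    have h3 := (mul_eq_zero.1 h2.symm).resolve_left (Finset.prod_ne_zero_iff.2 fun O' _ => hs O')
    exact_mod_cast h3
  simpa using hli.fintype_card_le_finrank

variable (F K) in
/-- The set of rational places of `K/F`. -/
def rationalPlaces : Set (ValuationSubring K) := {O | IsRationalPlace F O}

variable (F) in
/-- The set of rational places of `K/F` at which `u` vanishes. -/
def rationalZeros (u : K) : Set (ValuationSubring K) :=
  {O | IsRationalPlace F O ∧ O.valuation u < 1}

open scoped IntermediateField in
-- Finiteness of the set of zeros is part of the conclusion, hence `encard`: an infinite set would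
-- also contain one more zero than the degree allows.
theorem encard_rationalZeros_le [Fintype F] {u : K} (hu0 : u ≠ 0) [FiniteDimensional F⟮u⟯ K] :
    (rationalZeros F u).encard ≤ Module.finrank F⟮u⟯ K := by
  by_contra! h
  obtain ⟨t, ht, hcard⟩ := Set.exists_subset_encard_eq (Order.add_one_le_of_lt h)
  have hfin : t.Finite := Set.finite_of_encard_eq_coe (k := Module.finrank F⟮u⟯ K + 1) hcard
  have h1 := card_le_finrank_of_valuation_lt_one (F := F) hu0 hfin.toFinset
    (fun O hO => (ht (hfin.mem_toFinset.1 hO)).1) (fun O hO => (ht (hfin.mem_toFinset.1 hO)).2)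
  rw [hfin.encard_eq_coe_toFinset_card] at hcard
  have h2 : hfin.toFinset.card = Module.finrank F⟮u⟯ K + 1 := by exact_mod_cast hcard
  omega

/-- The rational places at which the function `θ` takes the value `c`. -/
def rationalFiber (θ : K) : Option F → Set (ValuationSubring K)
  | none => rationalZeros F θ⁻¹
  | some c => rationalZeros F (θ - algebraMap F K c)

theorem iUnion_rationalFiber (θ : K) :
    ⋃ c : Option F, rationalFiber θ c = rationalPlaces F K := by
  ext O
  simp only [Set.mem_iUnion]
  constructor
  · rintro ⟨_ | c, h⟩
    exacts [h.1, h.1]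
  · intro hO
    by_cases h : θ ∈ O
    · obtain ⟨c, hc⟩ := hO.exists_residue θ h
      exact ⟨some c, hO, hc⟩
    · refine ⟨none, hO, ?_⟩
      rw [map_inv₀]
      exact inv_lt_one_of_one_lt₀ (not_le.1 fun h' => h ((O.valuation_le_one_iff _).1 h'))

open scoped IntermediateField in
-- Each fibre is the set of zeros of θ⁻¹ or of θ - c, and these generate the same field as θ.
theorem encard_rationalFiber_le [Fintype F] {θ : K} (hθ : Transcendental F θ)
    [FiniteDimensional F⟮θ⟯ K] (c : Option F) :
    (rationalFiber θ c).encard ≤ Module.finrank F⟮θ⟯ K := by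
  have aux : ∀ u : K, u ≠ 0 → F⟮u⟯ = F⟮θ⟯ →
      (rationalZeros F u).encard ≤ Module.finrank F⟮θ⟯ K := by
    intro u hu h
    have : FiniteDimensional F⟮u⟯ K := h ▸ inferInstance
    rw [← h]
    exact encard_rationalZeros_le hu
  have hθ0 : ∀ c : F, θ ≠ algebraMap F K c := by
    rintro c rfl
    exact hθ (isAlgebraic_algebraMap c)
  rcases c with _ | c
  · refine aux _ (inv_ne_zero fun h => hθ0 0 (by simpa using h)) (le_antisymm ?_ ?_)
    · rw [IntermediateField.adjoin_simple_le_iff]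
      exact inv_mem (IntermediateField.mem_adjoin_simple_self F θ)
    · rw [IntermediateField.adjoin_simple_le_iff]
      simpa using inv_mem (IntermediateField.mem_adjoin_simple_self F θ⁻¹)
  · refine aux _ (sub_ne_zero.2 (hθ0 c)) (le_antisymm ?_ ?_)
    · rw [IntermediateField.adjoin_simple_le_iff]
      exact sub_mem (IntermediateField.mem_adjoin_simple_self F θ)
        (IntermediateField.algebraMap_mem _ c)
    · rw [IntermediateField.adjoin_simple_le_iff]
      simpa using add_mem (IntermediateField.mem_adjoin_simple_self F (θ - algebraMap F K c))
        (IntermediateField.algebraMap_mem F⟮θ - algebraMap F K c⟯ c)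

open scoped IntermediateField in
theorem finite_rationalPlaces [Fintype F] {θ : K} (hθ : Transcendental F θ)
    [FiniteDimensional F⟮θ⟯ K] : (rationalPlaces F K).Finite := by
  rw [← iUnion_rationalFiber (F := F) θ]
  exact Set.finite_iUnion fun c => Set.finite_of_encard_le_coe (encard_rationalFiber_le hθ c)

open scoped IntermediateField in
theorem ncard_rationalFiber_le [Fintype F] {θ : K} (hθ : Transcendental F θ)
    [FiniteDimensional F⟮θ⟯ K] (c : Option F) :
    (rationalFiber θ c).ncard ≤ Module.finrank F⟮θ⟯ K := by
  have h := encard_rationalFiber_le hθ c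
  rw [← (Set.finite_of_encard_le_coe h).cast_ncard_eq] at h
  exact_mod_cast h

theorem ncard_rationalPlaces_le_sum [Fintype F] (θ : K) :
    (rationalPlaces F K).ncard ≤ ∑ c : Option F, (rationalFiber θ c).ncard := by
  rw [← iUnion_rationalFiber (F := F) θ]
  exact Set.ncard_iUnion_le_of_fintype _

open scoped IntermediateField in
/-- A function of degree `n` on a curve over `F` with `q` elements shows that the curve has at most
`n (q + 1)` rational places. -/
theorem ncard_rationalPlaces_le [Fintype F] {θ : K} (hθ : Transcendental F θ)
    [FiniteDimensional F⟮θ⟯ K] :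
    (rationalPlaces F K).ncard ≤ Module.finrank F⟮θ⟯ K * (Fintype.card F + 1) := by
  refine (ncard_rationalPlaces_le_sum θ).trans
    ((Finset.sum_le_card_nsmul _ _ _ fun c _ => ncard_rationalFiber_le hθ c).trans_eq ?_)
  rw [Finset.card_univ, Fintype.card_option, smul_eq_mul, mul_comm]

open scoped IntermediateField in
/-- If the bound for the number of rational places is attained, then every fibre is full. -/
theorem ncard_rationalFiber_eq [Fintype F] {θ : K} (hθ : Transcendental F θ)
    [FiniteDimensional F⟮θ⟯ K]
    (h : (rationalPlaces F K).ncard = Module.finrank F⟮θ⟯ K * (Fintype.card F + 1))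
    (c : Option F) : (rationalFiber θ c).ncard = Module.finrank F⟮θ⟯ K := by
  by_contra hne
  have h1 := ncard_rationalPlaces_le_sum (F := F) θ
  have h2 := Finset.sum_lt_sum (fun c _ => ncard_rationalFiber_le hθ c)
    ⟨c, Finset.mem_univ c, (ncard_rationalFiber_le hθ c).lt_of_ne hne⟩
  rw [Finset.sum_const, Finset.card_univ, Fintype.card_option, smul_eq_mul, mul_comm] at h2
  omega

end RationalPlaces

/-! ### Separability of the algebraic elements of F((T)) over F(T). -/

section Separability

variable {F : Type*} [Field F]

/-- Over a perfect field, the `p`-th powers generate `F[T]` together with `1, T, …, T ^ (p - 1)`. -/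
theorem exists_eq_sum_X_pow_mul_pow (p : ℕ) [Fact p.Prime] [CharP F p] [PerfectRing F p]
    (c : F[X]) : ∃ a : Fin p → F[X], c = ∑ j : Fin p, X ^ (j : ℕ) * a j ^ p := by
  have hp : 0 < p := (Fact.out : p.Prime).pos
  induction c using Polynomial.induction_on' with
  | add f g hf hg =>
    obtain ⟨a, ha⟩ := hf
    obtain ⟨b, hb⟩ := hg
    refine ⟨a + b, ?_⟩
    rw [ha, hb, ← Finset.sum_add_distrib]
    refine Finset.sum_congr rfl fun j _ => ?_
    rw [Pi.add_apply, add_pow_char, mul_add]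
  | monomial n c =>
    obtain ⟨b, rfl⟩ := (bijective_frobenius F p).2 c
    refine ⟨Pi.single ⟨n % p, Nat.mod_lt _ hp⟩ (monomial (n / p) b), ?_⟩
    rw [Finset.sum_eq_single ⟨n % p, Nat.mod_lt _ hp⟩]
    · rw [Pi.single_eq_same, monomial_pow, X_pow_mul_monomial, frobenius_def, Nat.div_add_mod']
    · intro j _ hj
      rw [Pi.single_eq_of_ne hj, zero_pow hp.ne', mul_zero]
    · exact fun h => absurd (Finset.mem_univ _) h

/-- In `F((T))`, the elements `1, T, …, T ^ (p - 1)` are independent over `p`-th powers. -/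
theorem eq_zero_of_sum_single_pow_mul_pow (p : ℕ) (a : Fin p → LaurentSeries F)
    (h : ∑ j : Fin p, (HahnSeries.single (1 : ℤ) (1 : F)) ^ (j : ℕ) * a j ^ p = 0) (j : Fin p) :
    a j = 0 := by
  classical
  by_contra hj
  set T : LaurentSeries F := HahnSeries.single (1 : ℤ) (1 : F) with hT
  have hT0 : T ≠ 0 := by
    rw [hT, Ne, HahnSeries.single_eq_zero_iff]
    exact one_ne_zero
  -- The orders of the nonzero terms are distinct modulo p, so the term of least order cannot be
  -- cancelled.
  have hord : ∀ j, a j ≠ 0 → (T ^ (j : ℕ) * a j ^ p).order = (j : ℤ) + p * (a j).order := by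
    intro j hj
    rw [HahnSeries.order_mul (pow_ne_zero _ hT0) (pow_ne_zero _ hj), HahnSeries.order_pow,
      HahnSeries.order_pow, hT, HahnSeries.order_single one_ne_zero]
    simp
  obtain ⟨i, hi, hmin⟩ := Finset.exists_min_image (Finset.univ.filter fun j => a j ≠ 0)
    (fun j => (T ^ (j : ℕ) * a j ^ p).order) ⟨j, by simpa using hj⟩
  simp only [Finset.mem_filter, Finset.mem_univ, true_and] at hi hmin
  have h1 := congrArg (fun x : LaurentSeries F => x.coeff (T ^ (i : ℕ) * a i ^ p).order) h
  simp only [HahnSeries.coeff_sum, HahnSeries.coeff_zero] at h1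
  rw [Finset.sum_eq_single i] at h1
  · rw [HahnSeries.coeff_order_eq_zero] at h1
    exact mul_ne_zero (pow_ne_zero _ hT0) (pow_ne_zero _ hi) h1
  · intro k _ hk
    by_cases hk0 : a k = 0
    · have hp : p ≠ 0 := fun h => by
        subst h
        exact k.elim0
      rw [hk0, zero_pow hp, mul_zero, HahnSeries.coeff_zero]
    · refine HahnSeries.coeff_eq_zero_of_lt_order (lt_of_le_of_ne (hmin k hk0) fun heq => hk ?_)
      rw [hord i hi, hord k hk0] at heq
      have h2 := congrArg (· % (p : ℤ)) heq
      simp only [Int.add_mul_emod_self_left] at h2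
      rw [Int.emod_eq_of_lt (by positivity) (by exact_mod_cast i.2),
        Int.emod_eq_of_lt (by positivity) (by exact_mod_cast k.2)] at h2
      exact Fin.ext (by exact_mod_cast h2.symm)
  · exact fun h => absurd (Finset.mem_univ _) h

open scoped RatFunc in
/-- If `F` is perfect, the elements of `F((T))` that are algebraic over `F(T)` are separable. -/
theorem separable_of_irreducible_of_eval₂_eq_zero [PerfectField F] {g : (RatFunc F)[X]}
    (hg : Irreducible g) {β : LaurentSeries F} (hβ : g.eval₂ (toLaurent F) β = 0) :
    g.Separable := by
  replace hβ : aeval β g = 0 := hβ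
  rcases CharP.exists' F with h0 | ⟨p, hp, hF⟩
  · have : CharZero (RatFunc F) := charZero_of_injective_algebraMap (algebraMap F _).injective
    exact hg.separable
  have : CharP (RatFunc F) p := charP_of_injective_algebraMap (algebraMap F _).injective p
  have : CharP (LaurentSeries F) p :=
    charP_of_injective_algebraMap (algebraMap (RatFunc F) _).injective p
  have hp0 : 0 < p := hp.out.pos
  -- An inseparable irreducible polynomial in characteristic p has the form f(x ^ p).
  rcases separable_or p hg with h | ⟨-, f, hf, rfl⟩
  · exact h
  exfalso
  obtain ⟨b, hb, hc⟩ := IsLocalization.integerNormalization_spec (nonZeroDivisors F[X]) f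
  set c := IsLocalization.integerNormalization (nonZeroDivisors F[X]) f with hcdef
  have hc0 : c ≠ 0 := by
    rw [hcdef, Ne, IsFractionRing.integerNormalization_eq_zero_iff]
    exact hf.ne_zero
  have hdeg : c.natDegree ≤ f.natDegree := by
    have hinj : Function.Injective (algebraMap F[X] (RatFunc F)) := IsFractionRing.injective _ _
    rw [← natDegree_map_eq_of_injective hinj, hc]
    exact natDegree_smul_le _ _
  choose a ha using fun i => exists_eq_sum_X_pow_mul_pow p (c.coeff i)
  have hroot : aeval (β ^ p) (c.map (algebraMap F[X] (RatFunc F))) = 0 := by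
    rw [hc, Algebra.smul_def, map_mul, ← expand_aeval p f, hβ, mul_zero]
  -- With the coefficients of c written as sums of T ^ j a_ij ^ p, the relation c(β ^ p) = 0 becomes
  -- ∑ T ^ j h_j(β) ^ p = 0, which forces every h_j(β) to vanish.
  let h : Fin p → (RatFunc F)[X] := fun j =>
    ∑ i ∈ Finset.range (c.natDegree + 1), monomial i (algebraMap F[X] (RatFunc F) (a i j))
  have hX : algebraMap (RatFunc F) (LaurentSeries F) (algebraMap F[X] (RatFunc F) X) =
      HahnSeries.single (1 : ℤ) (1 : F) := by
    rw [RatFunc.algebraMap_X]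
    exact RatFunc.coe_X
  have hsum : ∑ j : Fin p, (HahnSeries.single (1 : ℤ) (1 : F)) ^ (j : ℕ) * aeval β (h j) ^ p =
      0 := by
    rw [← hroot, aeval_map_algebraMap, aeval_eq_sum_range]
    simp only [h, map_sum, aeval_monomial, sum_pow_char, mul_pow, Finset.mul_sum]
    rw [Finset.sum_comm]
    refine Finset.sum_congr rfl fun i _ => ?_
    rw [Algebra.smul_def, IsScalarTower.algebraMap_apply F[X] (RatFunc F) (LaurentSeries F),
      ha i, map_sum, map_sum, Finset.sum_mul]
    refine Finset.sum_congr rfl fun j _ => ?_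
    rw [map_mul, map_mul, map_pow, map_pow, map_pow, map_pow, hX]
    ring
  have hz := eq_zero_of_sum_single_pow_mul_pow p _ hsum
  obtain ⟨j, hj⟩ : ∃ j, a c.natDegree j ≠ 0 := by
    by_contra! hall
    refine hc0 (leadingCoeff_eq_zero.1 ?_)
    rw [leadingCoeff, ha]
    simp [hall, hp0.ne']
  have hhj : h j ≠ 0 := by
    intro h0
    have h1 := congrArg (coeff · c.natDegree) h0
    simp only [h, finsetSum_coeff, coeff_monomial, coeff_zero] at h1
    rw [Finset.sum_ite_eq' , if_pos (by simp)] at h1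
    exact hj ((map_eq_zero_iff _ (IsFractionRing.injective _ _)).1 h1)
  -- The degree of β over F(T) is p deg f, yet β is a root of the nonzero polynomial `h j` of degree
  -- at most deg f.
  have h1 := minpoly.degree_le_of_ne_zero (RatFunc F) β hhj (hz j)
  have h2 := natDegree_le_natDegree h1
  rw [← minpoly.eq_of_irreducible hg hβ,
    natDegree_mul_C (inv_ne_zero (leadingCoeff_ne_zero.2 hg.ne_zero)), natDegree_expand] at h2
  have h3 : (h j).natDegree ≤ c.natDegree := by
    refine natDegree_sum_le_of_forall_le _ _ fun i hi => (natDegree_monomial_le _).trans ?_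
    simpa [Nat.lt_succ_iff] using hi
  have h4 := hf.natDegree_pos
  have h5 := hp.out.two_le
  nlinarith

theorem toLaurent_ratFuncC (c : F) : toLaurent F (RatFunc.C c) = HahnSeries.C c := by
  have h := RatFunc.coe_coe (C c)
  rw [Polynomial.coe_C, HahnSeries.ofPowerSeries_C] at h
  rw [h, ← RatFunc.algebraMap_C]
  rfl

end Separability

/-! ### Places obtained from embeddings into F((T)). -/

section LaurentPlaces

variable {F K : Type*} [Field F] [Field K] [Algebra F K]

theorem pos_iff_neg_of_add_eq_zero {a b : WithTop ℤ} (h : a + b = 0) : 0 < a ↔ b < 0 := by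
  cases a with
  | top => simp at h
  | coe a =>
    cases b with
    | top => simp at h
    | coe b =>
      have h' : a + b = 0 := by exact_mod_cast h
      have : 0 < a ↔ b < 0 := by omega
      exact_mod_cast this

variable (F) in
/-- The ring `F[[T]]`, as a valuation ring of `F((T))`. -/
def laurentIntegers : ValuationSubring (LaurentSeries F) where
  carrier := {x | 0 ≤ x.orderTop}
  mul_mem' ha hb := by
    rw [Set.mem_ofPred_eq] at ha hb ⊢
    rw [HahnSeries.orderTop_mul]
    exact add_nonneg ha hb
  one_mem' := by simp [HahnSeries.orderTop_one]
  add_mem' ha hb := by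
    rw [Set.mem_ofPred_eq] at ha hb ⊢
    exact (le_min ha hb).trans HahnSeries.min_orderTop_le_orderTop_add
  zero_mem' := by simp
  neg_mem' := by simp
  mem_or_inv_mem' x := by
    simp only [Set.mem_ofPred_eq]
    by_cases hx : x = 0
    · simp [hx]
    · have h := HahnSeries.orderTop_mul x x⁻¹
      rw [mul_inv_cancel₀ hx, HahnSeries.orderTop_one] at h
      by_contra! hcon
      exact hcon.1.not_gt ((pos_iff_neg_of_add_eq_zero h.symm).2 hcon.2)

theorem mem_laurentIntegers {x : LaurentSeries F} : x ∈ laurentIntegers F ↔ 0 ≤ x.orderTop := by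
  change x ∈ {x : LaurentSeries F | 0 ≤ x.orderTop} ↔ _
  rw [Set.mem_ofPred_eq]

/-- The valuation ring of `K` given by an embedding of `K` into `F((T))`. -/
noncomputable def laurentPlace (σ : K →+* LaurentSeries F) : ValuationSubring K :=
  (laurentIntegers F).comap σ

omit [Algebra F K] in
theorem mem_laurentPlace {σ : K →+* LaurentSeries F} {x : K} :
    x ∈ laurentPlace σ ↔ 0 ≤ (σ x).orderTop :=
  mem_laurentIntegers

omit [Algebra F K] in
theorem laurentPlace_valuation_lt_one {σ : K →+* LaurentSeries F} {x : K} :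
    (laurentPlace σ).valuation x < 1 ↔ 0 < (σ x).orderTop := by
  by_cases hx : x = 0
  · simp [hx]
  have h := HahnSeries.orderTop_mul (σ x) (σ x⁻¹)
  rw [← map_mul, mul_inv_cancel₀ hx, map_one, HahnSeries.orderTop_one] at h
  have h1 : (laurentPlace σ).valuation x < 1 ↔ x⁻¹ ∉ laurentPlace σ := by
    rw [← ValuationSubring.valuation_le_one_iff, map_inv₀,
      inv_le_one₀ (by rw [zero_lt_iff]; simpa using hx), not_le]
  rw [h1, mem_laurentPlace, not_le, pos_iff_neg_of_add_eq_zero h.symm]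

variable {σ τ : K →+* LaurentSeries F}

theorem orderTop_C_nonneg (c : F) : 0 ≤ (HahnSeries.C c : LaurentSeries F).orderTop :=
  HahnSeries.orderTop_single_le

theorem orderTop_sub_C_coeff_zero {x : LaurentSeries F} (hx : 0 ≤ x.orderTop) :
    0 < (x - HahnSeries.C (x.coeff 0)).orderTop := by
  have h0 : (0 : WithTop ℤ) ≤ (x - HahnSeries.C (x.coeff 0)).orderTop := by
    rw [← mem_laurentIntegers] at hx ⊢
    exact sub_mem hx (mem_laurentIntegers.2 (orderTop_C_nonneg _))
  refine lt_of_le_of_ne h0 fun h => ?_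
  refine HahnSeries.coeff_orderTop_ne (g := 0) h.symm ?_
  simp [HahnSeries.C_apply]

theorem isRationalPlace_laurentPlace (hσ : ∀ c, σ (algebraMap F K c) = HahnSeries.C c) :
    IsRationalPlace F (laurentPlace σ) where
  algebraMap_mem c := by
    rw [mem_laurentPlace, hσ]
    exact orderTop_C_nonneg c
  exists_residue x hx := by
    refine ⟨(σ x).coeff 0, ?_⟩
    rw [laurentPlace_valuation_lt_one, map_sub, hσ]
    exact orderTop_sub_C_coeff_zero (mem_laurentPlace.1 hx)

/-- An embedding of `K` into `F((T))` is determined by the place that it induces. -/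
theorem laurentPlace_injective (hσ : ∀ c, σ (algebraMap F K c) = HahnSeries.C c)
    (hτ : ∀ c, τ (algebraMap F K c) = HahnSeries.C c) {t : K}
    (hσt : σ t = HahnSeries.single 1 1) (hτt : τ t = HahnSeries.single 1 1)
    (h : laurentPlace σ = laurentPlace τ) : σ = τ := by
  have ht0 : t ≠ 0 := by
    rintro rfl
    rw [map_zero] at hσt
    exact one_ne_zero (HahnSeries.single_eq_zero_iff.1 hσt.symm)
  have horder : (HahnSeries.single (1 : ℤ) (1 : F)).orderTop = 1 :=
    HahnSeries.orderTop_single one_ne_zero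
  -- The place determines the T-adic expansion digit by digit: subtract the residue, divide by t,
  -- and repeat. Both embeddings send t to T, so they agree to every order.
  have key : ∀ n : ℕ, ∀ x ∈ laurentPlace σ, (n : WithTop ℤ) ≤ (σ x - τ x).orderTop := by
    intro n
    induction n with
    | zero =>
      intro x hx
      have hx' : x ∈ laurentPlace τ := h ▸ hx
      exact mem_laurentIntegers.1
        (sub_mem (mem_laurentIntegers.2 (mem_laurentPlace.1 hx))
          (mem_laurentIntegers.2 (mem_laurentPlace.1 hx')))
    | succ n ih =>
      intro x hx
      obtain ⟨c, hc⟩ := (isRationalPlace_laurentPlace hσ).exists_residue x hx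
      set y := (x - algebraMap F K c) / t with hy
      have hxy : x = algebraMap F K c + t * y := by
        rw [hy, mul_div_cancel₀ _ ht0]
        ring
      have hyO : y ∈ laurentPlace σ := by
        rw [laurentPlace_valuation_lt_one, hxy, add_sub_cancel_left, map_mul, hσt,
          HahnSeries.orderTop_mul, horder] at hc
        rw [mem_laurentPlace]
        cases h2 : (σ y).orderTop with
        | top => exact le_top
        | coe a =>
          rw [h2] at hc
          have h3 : (0 : ℤ) < 1 + a := by exact_mod_cast hc
          have h4 : (0 : ℤ) ≤ a := by omega
          exact_mod_cast h4
      have h5 : σ x - τ x = HahnSeries.single 1 1 * (σ y - τ y) := by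
        conv_lhs => rw [hxy]
        rw [map_add, map_add, map_mul, map_mul, hσ, hτ, hσt, hτt]
        ring
      rw [h5, HahnSeries.orderTop_mul, horder, Nat.cast_succ, add_comm]
      exact add_le_add_right (ih y hyO) _
  have hO : ∀ x ∈ laurentPlace σ, σ x = τ x := by
    intro x hx
    by_contra hne
    cases h2 : (σ x - τ x).orderTop with
    | top => exact hne (sub_eq_zero.1 (HahnSeries.orderTop_eq_top.1 h2))
    | coe a =>
      have h3 := key (a.toNat + 1) x hx
      rw [h2] at h3
      have h4 : ((a.toNat + 1 : ℕ) : ℤ) ≤ a := by exact_mod_cast h3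
      omega
  ext1 x
  rcases (laurentPlace σ).mem_or_inv_mem x with hx | hx
  · exact hO x hx
  · have h1 := hO _ hx
    rwa [map_inv₀, map_inv₀, inv_inj] at h1

end LaurentPlaces

open scoped IntermediateField

/-! ### The degree of K over the subfield generated by one function. -/

section FiniteExtensions

variable {F K : Type*} [Field F] [Field K] [Algebra F K]

open scoped IntermediateField.algebraAdjoinAdjoin in
/-- A field that is finite over `F(a)` is finite over `F(θ)` for every `θ` transcendental
over `F`. -/
theorem finiteDimensional_adjoin_of_transcendental (a : K) [FiniteDimensional F⟮a⟯ K] {θ : K}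
    (hθ : Transcendental F θ) : FiniteDimensional F⟮θ⟯ K := by
  have halg : Algebra.IsAlgebraic (Algebra.adjoin F {a}) K :=
    (IsFractionRing.comap_isAlgebraic_iff (K := F⟮a⟯)).2 inferInstance
  -- In transcendence degree at most 1, θ alone is a transcendence basis. Thus K is algebraic and
  -- finitely generated over F(θ), hence finite.
  have htr : Algebra.trdeg F K ≤ 1 := by
    simpa using Algebra.IsAlgebraic.trdeg_le_cardinalMk F ({a} : Set K)
  have hind : AlgebraicIndependent F ((↑) : ({θ} : Set K) → K) := by
    rw [algebraicIndependent_unique_type_iff]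
    exact hθ
  have hbasis := hind.isTranscendenceBasis_of_trdeg_le_of_finite (by simpa using htr)
  have h1 : Algebra.IsAlgebraic F⟮θ⟯ K := by
    have h := hbasis.isAlgebraic_field
    rwa [Subtype.range_coe] at h
  have h2 : Algebra.EssFiniteType F F⟮a⟯ := by
    rw [IntermediateField.essFiniteType_iff]
    exact ⟨{a}, by simp⟩
  have h3 : Algebra.EssFiniteType F K := .comp F F⟮a⟯ K
  have h4 : Algebra.EssFiniteType F⟮θ⟯ K := .of_comp F F⟮θ⟯ K
  exact Algebra.finite_of_essFiniteType_of_isAlgebraic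

variable [Algebra (RatFunc F) K] [IsScalarTower F (RatFunc F) K]

/-- If `f ∈ F[T][x]` vanishes at a generator `a` of `K` over `F(T)`, then `K` has degree at most
`deg_T f` over `F(a)`. -/
theorem finiteDimensional_adjoin_and_finrank_le {a : K} (ha : Transcendental F a)
    (hgen : (RatFunc F)⟮a⟯ = ⊤) {f : F[X][X]} (hf0 : f ≠ 0)
    (hroot : aeval a (f.map (algebraMap F[X] (RatFunc F))) = 0) :
    FiniteDimensional F⟮a⟯ K ∧ Module.finrank F⟮a⟯ K ≤ degreeT f := by
  set t : K := algebraMap (RatFunc F) K RatFunc.X with ht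
  have haeval : ∀ p : F[X], algebraMap (RatFunc F) K (algebraMap F[X] (RatFunc F) p) =
      aeval t p := by
    intro p
    rw [ht, aeval_algebraMap_apply, RatFunc.aeval_X_left_eq_algebraMap]
  let g : F⟮a⟯ := IntermediateField.AdjoinSimple.gen F a
  have hg : Transcendental F g := by
    intro h
    exact ha (h.algebraMap (A := K))
  -- The roles of the variables are exchanged: substituting a for x in f leaves a polynomial in T
  -- over F(a), of degree at most deg_T f and with root t.
  let G : F⟮a⟯[X] := ∑ i ∈ Finset.range (f.natDegree + 1),
    (f.coeff i).map (algebraMap F F⟮a⟯) * C (g ^ i)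
  have hGdeg : G.natDegree ≤ degreeT f := by
    refine natDegree_sum_le_of_forall_le _ _ fun i _ => ?_
    refine (natDegree_mul_C_le _ _).trans ((natDegree_map_le).trans ?_)
    by_cases hi : i ∈ f.support
    · exact Finset.le_sup (f := fun i => (f.coeff i).natDegree) hi
    · rw [notMem_support_iff.1 hi]
      simp
  have hG0 : G ≠ 0 := by
    intro h0
    obtain ⟨i, hi⟩ : ∃ i, f.coeff i ≠ 0 := ⟨f.natDegree, by simpa using hf0⟩
    obtain ⟨j, hj⟩ : ∃ j, (f.coeff i).coeff j ≠ 0 := ⟨(f.coeff i).natDegree, by simpa using hi⟩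
    -- If G were zero, the coefficient of T ^ j in f would be a nonzero polynomial in x over F
    -- vanishing at a.
    let P : F[X] := ∑ i ∈ Finset.range (f.natDegree + 1), monomial i ((f.coeff i).coeff j)
    have hP : aeval g P = 0 := by
      rw [← coeff_zero j, ← h0]
      simp only [P, G, map_sum, aeval_monomial, finsetSum_coeff, coeff_mul_C, coeff_map]
    have hP0 : P ≠ 0 := by
      intro hP0
      have h1 := congrArg (coeff · i) hP0
      simp only [P, finsetSum_coeff, coeff_monomial, coeff_zero] at h1
      rw [Finset.sum_ite_eq', if_pos] at h1
      · exact hj h1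
      · rw [Finset.mem_range, Nat.lt_succ_iff]
        exact le_natDegree_of_ne_zero hi
    exact hg ⟨P, hP0, hP⟩
  have hGt : aeval t G = 0 := by
    rw [← hroot, aeval_eq_sum_range (p := f.map _),
      natDegree_map_eq_of_injective (IsFractionRing.injective _ _)]
    simp only [G, map_sum, map_mul, aeval_C, aeval_map_algebraMap, coeff_map, Algebra.smul_def,
      haeval, map_pow]
    rfl
  have htint : IsIntegral F⟮a⟯ t := (show IsAlgebraic F⟮a⟯ t from ⟨G, hG0, hGt⟩).isIntegral
  have htop : F⟮a⟯⟮t⟯ = ⊤ := by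
    have hmem : ∀ r : RatFunc F, algebraMap (RatFunc F) K r ∈ F⟮a⟯⟮t⟯.toSubfield := by
      have h1 : ∀ p : F[X], aeval t p ∈ F⟮a⟯⟮t⟯ := by
        intro p
        rw [← aeval_map_algebraMap F⟮a⟯]
        exact IntermediateField.algebra_adjoin_le_adjoin _ _ (aeval_mem_adjoin_singleton _ _)
      intro r
      rw [← RatFunc.num_div_denom r, map_div₀, haeval, haeval]
      exact div_mem (h1 _) (h1 _)
    have h2 : (RatFunc F)⟮a⟯ ≤ F⟮a⟯⟮t⟯.toSubfield.toIntermediateField hmem := by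
      rw [IntermediateField.adjoin_simple_le_iff]
      exact IntermediateField.algebraMap_mem F⟮a⟯⟮t⟯ g
    rw [hgen] at h2
    exact top_le_iff.1 fun x _ => h2 (IntermediateField.mem_top (x := x))
  have hfd : FiniteDimensional F⟮a⟯ F⟮a⟯⟮t⟯ := IntermediateField.adjoin.finiteDimensional htint
  rw [htop] at hfd
  have hfd' : FiniteDimensional F⟮a⟯ K := Module.Finite.equiv
    (IntermediateField.topEquiv (F := F⟮a⟯) (E := K)).toLinearEquiv
  refine ⟨hfd', ?_⟩
  rw [← IntermediateField.finrank_top' (F := F⟮a⟯) (E := K), ← htop,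
    IntermediateField.adjoin.finrank htint]
  exact (natDegree_le_natDegree (minpoly.degree_le_of_ne_zero _ _ hG0 hGt)).trans hGdeg

end FiniteExtensions

/-! ### Counting the rational places of F(T)(α). -/

section Main

variable {F : Type u} [Field F]

variable (F) in
/-- The field `F((T))` as an extension of `F(T)`. -/
noncomputable abbrev laurentAlgebra : Algebra (RatFunc F) (LaurentSeries F) :=
  (toLaurent F).toAlgebra

attribute [local instance] laurentAlgebra

theorem natDegree_integralMinpoly (α : AlgebraicClosure (RatFunc F)) :
    (integralMinpoly α).natDegree = (minpoly (RatFunc F) α).natDegree := by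
  have h := isIntegralMinpoly_integralMinpoly α
  rw [← minpoly.eq_of_irreducible h.irreducible h.aeval_eq_zero,
    natDegree_mul_C (inv_ne_zero (leadingCoeff_ne_zero.2 h.irreducible.ne_zero)),
    natDegree_map_eq_of_injective (IsFractionRing.injective _ _)]

theorem adjoin_gen_eq_top (α : AlgebraicClosure (RatFunc F)) :
    (RatFunc F)⟮IntermediateField.AdjoinSimple.gen (RatFunc F) α⟯ = ⊤ := by
  have h := (IntermediateField.adjoin.powerBasis
    (Algebra.IsIntegral.isIntegral (R := RatFunc F) α)).adjoin_gen_eq_top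
  rw [IntermediateField.adjoin.powerBasis_gen] at h
  have : FiniteDimensional (RatFunc F) (RatFunc F)⟮α⟯ :=
    IntermediateField.adjoin.finiteDimensional (Algebra.IsIntegral.isIntegral α)
  exact (IntermediateField.adjoin_simple_eq_top_iff_of_isAlgebraic
    (Algebra.IsAlgebraic.isAlgebraic _)).2 h

/-- Separability makes the number of embeddings of F(T)(α) into F((T)) equal to the full degree of
α. -/
theorem isSeparable_of_isTotallyTAdic [PerfectField F] {α : AlgebraicClosure (RatFunc F)}
    (hα : IsTotallyTAdic α) : IsSeparable (RatFunc F) α := by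
  have hint : IsIntegral (RatFunc F) α := Algebra.IsIntegral.isIntegral α
  obtain ⟨β, hβ⟩ := Splits.exists_eval_eq_zero hα (by
    rw [degree_map]
    exact (minpoly.degree_pos hint).ne')
  refine separable_of_irreducible_of_eval₂_eq_zero (minpoly.irreducible hint) (β := β) ?_
  rwa [eval₂_eq_eval_map]

theorem transcendental_gen {α : AlgebraicClosure (RatFunc F)} (hα : ¬ IsAlgebraic F α) :
    Transcendental F (IntermediateField.AdjoinSimple.gen (RatFunc F) α) := by
  intro h
  obtain ⟨p, hp, hp0⟩ := h
  refine hα ⟨p, hp, ?_⟩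
  have h1 := congrArg (algebraMap (RatFunc F)⟮α⟯ (AlgebraicClosure (RatFunc F))) hp0
  rw [← aeval_map_algebraMap (RatFunc F), ← aeval_algebraMap_apply, map_zero,
    IntermediateField.AdjoinSimple.algebraMap_gen, aeval_map_algebraMap] at h1
  exact h1

/-- The algebraic content of the main theorem: the rational places of the function field
`F(T)(α)`. -/
theorem ncard_rationalPlaces_adjoin [Fintype F] {α : AlgebraicClosure (RatFunc F)}
    (hα : IsTotallyTAdic α) (hnonconst : ¬ IsAlgebraic F α)
    (hheight : height α = 1 / ((Fintype.card F : ℝ) + 1)) :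
    ∃ a : (RatFunc F)⟮α⟯, Transcendental F a ∧ FiniteDimensional F⟮a⟯ (RatFunc F)⟮α⟯ ∧
      (rationalPlaces F (RatFunc F)⟮α⟯).ncard = Module.finrank (RatFunc F) (RatFunc F)⟮α⟯ ∧
      Module.finrank (RatFunc F) (RatFunc F)⟮α⟯ =
        Module.finrank F⟮a⟯ (RatFunc F)⟮α⟯ * (Fintype.card F + 1) ∧
      Module.finrank F⟮a⟯ (RatFunc F)⟮α⟯ = (positiveConjugates α).ncard := by
  have hint : IsIntegral (RatFunc F) α := Algebra.IsIntegral.isIntegral α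
  set a : (RatFunc F)⟮α⟯ := IntermediateField.AdjoinSimple.gen (RatFunc F) α with ha
  have htr : Transcendental F a := transcendental_gen hnonconst
  set f := integralMinpoly α with hf
  have hfm := isIntegralMinpoly_integralMinpoly α
  have hroot : aeval a (f.map (algebraMap F[X] (RatFunc F))) = 0 := by
    apply (algebraMap (RatFunc F)⟮α⟯ (AlgebraicClosure (RatFunc F))).injective
    rw [← aeval_algebraMap_apply, map_zero, IntermediateField.AdjoinSimple.algebraMap_gen]
    exact hfm.aeval_eq_zero
  have hf0 : f ≠ 0 := hfm.isPrimitive.ne_zero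
  obtain ⟨hfd, hle⟩ := finiteDimensional_adjoin_and_finrank_le htr (adjoin_gen_eq_top α) hf0 hroot
  have hdeg : Module.finrank (RatFunc F) (RatFunc F)⟮α⟯ = f.natDegree := by
    rw [IntermediateField.adjoin.finrank hint, hf, natDegree_integralMinpoly]
  have hpos : 0 < f.natDegree := by
    rw [hf, natDegree_integralMinpoly]
    exact minpoly.natDegree_pos hint
  -- The height hypothesis with denominators cleared.
  have hdm : f.natDegree = degreeT f * (Fintype.card F + 1) := by
    rw [height, div_eq_div_iff (by exact_mod_cast hpos.ne') (by positivity), one_mul] at hheight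
    exact_mod_cast hheight.symm
  have hcard : Nat.card ((RatFunc F)⟮α⟯ →ₐ[RatFunc F] LaurentSeries F) = f.natDegree := by
    rw [hf, natDegree_integralMinpoly]
    exact IntermediateField.card_algHom_adjoin_integral (RatFunc F) hint
      (isSeparable_of_isTotallyTAdic hα) hα
  have hfinhom : Finite ((RatFunc F)⟮α⟯ →ₐ[RatFunc F] LaurentSeries F) :=
    Nat.finite_of_card_ne_zero (hcard ▸ hpos.ne')
  have hconst : ∀ (σ : (RatFunc F)⟮α⟯ →ₐ[RatFunc F] LaurentSeries F) (c : F),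
      (σ : (RatFunc F)⟮α⟯ →+* LaurentSeries F) (algebraMap F (RatFunc F)⟮α⟯ c) = HahnSeries.C c := by
    intro σ c
    rw [IsScalarTower.algebraMap_apply F (RatFunc F) (RatFunc F)⟮α⟯]
    refine (σ.commutes _).trans ?_
    rw [RatFunc.algebraMap_eq_C]
    exact toLaurent_ratFuncC c
  have hT : ∀ σ : (RatFunc F)⟮α⟯ →ₐ[RatFunc F] LaurentSeries F,
      (σ : (RatFunc F)⟮α⟯ →+* LaurentSeries F) (algebraMap (RatFunc F) (RatFunc F)⟮α⟯ RatFunc.X) =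
        HahnSeries.single 1 1 := by
    intro σ
    exact (σ.commutes _).trans toLaurent_X
  let place : ((RatFunc F)⟮α⟯ →ₐ[RatFunc F] LaurentSeries F) → ValuationSubring (RatFunc F)⟮α⟯ :=
    fun σ => laurentPlace (σ : (RatFunc F)⟮α⟯ →+* LaurentSeries F)
  have hinj : Function.Injective place := by
    intro σ τ h
    have h1 := laurentPlace_injective (hconst σ) (hconst τ) (hT σ) (hT τ) h
    exact AlgHom.ext fun x => RingHom.congr_fun h1 x
  have hsub : Set.range place ⊆ rationalPlaces F (RatFunc F)⟮α⟯ := by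
    rintro _ ⟨σ, rfl⟩
    exact isRationalPlace_laurentPlace (hconst σ)
  have hrange : (Set.range place).ncard = f.natDegree := by
    rw [← hcard, ← Set.image_univ, Set.ncard_image_of_injective _ hinj, Set.ncard_univ]
  have hfin := finite_rationalPlaces htr
  have hlow := Set.ncard_le_ncard hsub hfin
  have hup := ncard_rationalPlaces_le (F := F) htr
  -- This closes the chain d ≤ #places ≤ [K : F(a)] (q + 1) ≤ (q + 1) deg_T f = d, so all its terms
  -- are equal.
  have hmul : Module.finrank F⟮a⟯ (RatFunc F)⟮α⟯ * (Fintype.card F + 1) ≤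
      degreeT f * (Fintype.card F + 1) := Nat.mul_le_mul_right _ hle
  have hN : (rationalPlaces F (RatFunc F)⟮α⟯).ncard = f.natDegree := by omega
  have hm : f.natDegree = Module.finrank F⟮a⟯ (RatFunc F)⟮α⟯ * (Fintype.card F + 1) := by omega
  have hrange' : Set.range place = rationalPlaces F (RatFunc F)⟮α⟯ :=
    Set.eq_of_subset_of_ncard_le hsub (by omega) hfin
  refine ⟨a, htr, hfd, by rw [hN, hdeg], by rw [hdeg, hm], ?_⟩
  -- As the bound is attained, the number of rational zeros of a is exactly [K : F(a)]. Every
  -- rational place comes from an embedding, so these zeros can be counted by conjugates.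
  rw [← ncard_rationalFiber_eq htr (hN.trans hm) (some 0)]
  have h1 : rationalFiber a (some (0 : F)) = place '' {σ | 0 < (σ a).orderTop} := by
    ext O
    constructor
    · intro hO
      obtain ⟨σ, rfl⟩ : O ∈ Set.range place := hrange' ▸ hO.1
      refine ⟨σ, ?_, rfl⟩
      have h2 := hO.2
      rw [map_zero, sub_zero] at h2
      exact laurentPlace_valuation_lt_one.1 h2
    · rintro ⟨σ, hσ, rfl⟩
      refine ⟨isRationalPlace_laurentPlace (hconst σ), ?_⟩
      rw [map_zero, sub_zero]
      exact laurentPlace_valuation_lt_one.2 hσ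
  have h2 : positiveConjugates α =
      (fun σ : (RatFunc F)⟮α⟯ →ₐ[RatFunc F] LaurentSeries F => σ a) '' {σ | 0 < (σ a).orderTop} := by
    ext β
    constructor
    · rintro ⟨hβ, hβ0⟩
      have hβ' : β ∈ (minpoly (RatFunc F) α).aroots (LaurentSeries F) :=
        (mem_aroots.2 ⟨minpoly.ne_zero hint, hβ⟩)
      have h3 := IntermediateField.algHomAdjoinIntegralEquiv_symm_apply_gen (RatFunc F) hint
        ⟨β, hβ'⟩
      refine ⟨(IntermediateField.algHomAdjoinIntegralEquiv (RatFunc F) hint).symm ⟨β, hβ'⟩, ?_, h3⟩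
      rw [Set.mem_ofPred_eq]
      exact h3.symm ▸ hβ0
    · rintro ⟨σ, hσ, rfl⟩
      refine ⟨?_, hσ⟩
      change aeval (σ a) (minpoly (RatFunc F) α) = 0
      rw [aeval_algHom_apply, ← IntermediateField.minpoly_gen, minpoly.aeval, map_zero]
  have hinj2 : Function.Injective (fun σ : (RatFunc F)⟮α⟯ →ₐ[RatFunc F] LaurentSeries F => σ a) := by
    intro σ τ h
    apply (IntermediateField.algHomAdjoinIntegralEquiv (RatFunc F) hint).injective
    ext1
    exact h
  rw [h1, h2, Set.ncard_image_of_injective _ hinj, Set.ncard_image_of_injective _ hinj2]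

end Main

/-! ### Local rings of smooth curves -/

section SmoothCurves

open scoped TensorProduct

/-- The differentials of A are free of rank 1, and those of a localization are spanned by the images
of differentials of A. -/
theorem exists_forall_smul_eq_kaehlerDifferential {F A B : Type*} [Field F] [CommRing A]
    [Nontrivial A] [Algebra F A]
    [Algebra.IsStandardSmoothOfRelativeDimension 1 F A] [CommRing B] [Algebra A B] [Algebra F B]
    [IsScalarTower F A B] (M : Submonoid A) [IsLocalization M B] :
    ∃ ω : Ω[B⁄F], ∀ x, ∃ b : B, b • ω = x := by
  have := Algebra.IsStandardSmoothOfRelativeDimension.isStandardSmooth 1 (R := F) (S := A)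
  have hrank := Algebra.IsStandardSmoothOfRelativeDimension.rank_kaehlerDifferential 1 (R := F)
    (S := A)
  rw [Nat.cast_one, rank_eq_one_iff] at hrank
  obtain ⟨ω, -, hω⟩ := hrank
  refine ⟨KaehlerDifferential.map F F A B ω, fun x => ?_⟩
  have hx : x ∈ Submodule.span B
      (Set.range (KaehlerDifferential.map F F A B ∘ KaehlerDifferential.D F A)) := by
    rw [KaehlerDifferential.span_range_map_derivation_of_isLocalization F A B M]
    trivial
  rw [← Submodule.mem_span_singleton]
  refine Submodule.span_le.2 ?_ hx
  rintro _ ⟨a, rfl⟩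
  obtain ⟨c, hc⟩ := hω (KaehlerDifferential.D F A a)
  rw [Function.comp_apply, ← hc, map_smul, SetLike.mem_coe, Submodule.mem_span_singleton]
  exact ⟨algebraMap A B c, algebraMap_smul _ _ _⟩

/-- As κ is formally smooth over F, the map I/I² → κ ⊗ Ω has a left inverse. This left inverse is
surjective, so it carries a generator of κ ⊗ Ω to a generator of I/I². -/
theorem exists_forall_smul_eq_cotangent {F B κ : Type*} [Field F] [CommRing B] [CommRing κ]
    [Algebra F B] [Algebra F κ] [Algebra B κ] [IsScalarTower F B κ] [Algebra.FormallySmooth F B]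
    [Algebra.FormallySmooth F κ] (hsurj : Function.Surjective (algebraMap B κ))
    (hΩ : ∃ ω : Ω[B⁄F], ∀ x, ∃ b : B, b • ω = x) (I : Ideal B)
    (hI : RingHom.ker (algebraMap B κ) = I) :
    ∃ v : I.Cotangent, ∀ w, ∃ b : B, b • v = w := by
  subst hI
  obtain ⟨l, hl⟩ := (Algebra.FormallySmooth.iff_split_injection (R := F) (P := B) (A := κ)
    hsurj).1 inferInstance
  obtain ⟨ω, hω⟩ := hΩ
  have key : ∀ z : κ ⊗[B] Ω[B⁄F], ∃ b : B, b • (1 ⊗ₜ[B] ω : κ ⊗[B] Ω[B⁄F]) = z := by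
    intro z
    induction z with
    | zero => exact ⟨0, zero_smul _ _⟩
    | tmul k x =>
      obtain ⟨b, rfl⟩ := hω x
      obtain ⟨c, rfl⟩ := hsurj k
      refine ⟨c * b, ?_⟩
      rw [mul_comm, mul_smul, TensorProduct.smul_tmul', ← TensorProduct.tmul_smul,
        Algebra.algebraMap_eq_smul_one]
    | add x y hx hy =>
      obtain ⟨b, rfl⟩ := hx
      obtain ⟨c, rfl⟩ := hy
      exact ⟨b + c, add_smul _ _ _⟩
  refine ⟨l (1 ⊗ₜ ω), fun w => ?_⟩
  obtain ⟨b, hb⟩ := key (KaehlerDifferential.kerCotangentToTensor F B κ w)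
  exact ⟨b, by rw [← map_smul, hb]; exact LinearMap.congr_fun hl w⟩

/-- The residue field is formally smooth because F is perfect, so the cotangent space has dimension
at most 1; for a Noetherian local domain this means being a valuation ring. The form `ValuationRing`
also covers the generic point, where the local ring is a field. -/
theorem valuationRing_of_isStandardSmoothOfRelativeDimension_one {F A B : Type*} [Field F]
    [PerfectField F] [CommRing A] [Algebra F A]
    [Algebra.IsStandardSmoothOfRelativeDimension 1 F A] (p : Ideal A) [p.IsPrime] [CommRing B]
    [IsDomain B] [Algebra A B] [IsLocalization.AtPrime B p] : ValuationRing B := by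
  have := Algebra.IsStandardSmoothOfRelativeDimension.isStandardSmooth 1 (R := F) (S := A)
  let : Algebra F B := ((algebraMap A B).comp (algebraMap F A)).toAlgebra
  have : IsScalarTower F A B := IsScalarTower.of_algebraMap_eq fun _ => rfl
  have : IsLocalRing B := IsLocalization.AtPrime.isLocalRing B p
  have : Nontrivial A := ⟨0, 1, fun h => (inferInstance : p.IsPrime).one_notMem (h ▸ p.zero_mem)⟩
  have : IsNoetherianRing A := Algebra.FiniteType.isNoetherianRing F A
  have : IsNoetherianRing B := IsLocalization.isNoetherianRing p.primeCompl B inferInstance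
  have : Algebra.FormallySmooth A B := Algebra.FormallySmooth.of_isLocalization p.primeCompl
  have : Algebra.FormallySmooth F B := .comp F A B
  have : Algebra.EssFiniteType A B := Algebra.EssFiniteType.of_isLocalization _ p.primeCompl
  have : Algebra.EssFiniteType F B := .comp F A B
  have : Algebra.EssFiniteType F (IsLocalRing.ResidueField B) :=
    .comp F B (IsLocalRing.ResidueField B)
  have : Algebra.FormallySmooth F (IsLocalRing.ResidueField B) :=
    Algebra.FormallySmooth.of_perfectField
  obtain ⟨v, hv⟩ := exists_forall_smul_eq_cotangent (F := F) (B := B)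
    (κ := IsLocalRing.ResidueField B) IsLocalRing.residue_surjective
    (exists_forall_smul_eq_kaehlerDifferential p.primeCompl) (IsLocalRing.maximalIdeal B)
    IsLocalRing.ker_residue
  refine ((tfae_of_isNoetherianRing_of_isLocalRing_of_isDomain B).out 1 5).2 ?_
  refine finrank_le_one (R := IsLocalRing.ResidueField B) v fun w => ?_
  obtain ⟨b, hb⟩ := hv w
  exact ⟨algebraMap B _ b, by rw [algebraMap_smul, hb]⟩

theorem valuationRing_stalk {F : Type u} [Field F] [PerfectField F] {C : Scheme.{u}}
    [AlgebraicGeometry.IsIntegral C] (s : C ⟶ Spec (CommRingCat.of F))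
    [SmoothOfRelativeDimension 1 s] (x : C) : ValuationRing (C.presheaf.stalk x) := by
  obtain ⟨U, hU, V, hV, hx, h, hs⟩ :=
    SmoothOfRelativeDimension.exists_isStandardSmoothOfRelativeDimension (n := 1) (f := s) x
  -- Spec F is a single point, so the affine open of the base is everything.
  have hUtop : U = ⊤ := by
    have hmem : s x ∈ U := h hx
    ext y
    have : y = s x := Subsingleton.elim (α := PrimeSpectrum F) _ _
    simp [this, hmem]
  subst hUtop
  have hs' := RingHom.isStandardSmoothOfRelativeDimension_respectsIso.2 _
    (Scheme.ΓSpecIso (CommRingCat.of F)).symm.commRingCatIsoToRingEquiv hs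
  let := ((s.appLE ⊤ V h).hom.comp
    (Scheme.ΓSpecIso (CommRingCat.of F)).inv.hom : F →+* Γ(C, V)).toAlgebra
  have : Algebra.IsStandardSmoothOfRelativeDimension 1 F Γ(C, V) := hs'
  let := C.presheaf.algebra_section_stalk (⟨x, hx⟩ : V)
  have := hV.isLocalization_stalk ⟨x, hx⟩
  exact valuationRing_of_isStandardSmoothOfRelativeDimension_one (F := F) (A := Γ(C, V))
    (hV.primeIdealOf ⟨x, hx⟩).asIdeal

end SmoothCurves

/-! ### Rational points and rational places -/

section FractionRing

variable (R K : Type*) [CommRing R] [IsDomain R] [ValuationRing R] [Field K] [Algebra R K]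
  [IsFractionRing R K]

/-- A valuation ring as a valuation subring of its field of fractions. -/
def rangeValuationSubring : ValuationSubring K where
  __ := (algebraMap R K).range
  mem_or_inv_mem' x := ValuationRing.isInteger_or_isInteger R x

variable {R K}

theorem valuation_rangeValuationSubring_lt_one {r : R} (hr : ¬ IsUnit r) :
    (rangeValuationSubring R K).valuation (algebraMap R K r) < 1 := by
  have hmem : algebraMap R K r ∈ rangeValuationSubring R K := ⟨r, rfl⟩
  refine lt_of_le_of_ne ((ValuationSubring.valuation_le_one_iff _ _).2 hmem) fun h => hr ?_
  have hinv : (algebraMap R K r)⁻¹ ∈ rangeValuationSubring R K := by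
    rw [← ValuationSubring.valuation_le_one_iff, map_inv₀, h, inv_one]
  obtain ⟨t, ht⟩ := hinv
  refine IsUnit.of_mul_eq_one t (IsFractionRing.injective R K ?_)
  have h0 : algebraMap R K r ≠ 0 := by
    intro h0
    simp [h0] at h
  rw [map_mul, ht, map_one, mul_inv_cancel₀ h0]

end FractionRing

theorem IsRationalPlace.exists_residueHom {F K : Type*} [Field F] [Field K] [Algebra F K]
    {O : ValuationSubring K} (hO : IsRationalPlace F O) :
    ∃ r : O →+* F, (∀ c, r ⟨algebraMap F K c, hO.algebraMap_mem c⟩ = c) ∧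
      ∀ y : O, O.valuation (y - algebraMap F K (r y)) < 1 := by
  choose g hg using fun y : O => hO.exists_residue y y.2
  have key : ∀ {y : O} {c : F}, O.valuation (y - algebraMap F K c) < 1 → g y = c :=
    fun h => hO.residue_unique (hg _) h
  refine ⟨⟨⟨⟨g, ?_⟩, ?_⟩, ?_, ?_⟩, ?_, hg⟩
  · exact key (by simp)
  · intro x y
    refine key ?_
    have h : ((x * y : O) : K) - algebraMap F K (g x * g y) =
        x * (y - algebraMap F K (g y)) + (x - algebraMap F K (g x)) * algebraMap F K (g y) := by
      rw [map_mul, MulMemClass.coe_mul]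
      ring
    change O.valuation (((x * y : O) : K) - algebraMap F K (g x * g y)) < 1
    rw [h]
    refine O.valuation.map_add_lt ?_ ?_
    · rw [map_mul]
      exact mul_lt_one_of_nonneg_of_lt_one_right (O.valuation_le_one x) zero_le (hg y)
    · rw [map_mul]
      exact mul_lt_one_of_nonneg_of_lt_one_left zero_le (hg x) (hO.valuation_algebraMap_le _)
  · exact key (by simp)
  · intro x y
    refine key ?_
    have h : ((x + y : O) : K) - algebraMap F K (g x + g y) =
        (x - algebraMap F K (g x)) + (y - algebraMap F K (g y)) := by
      rw [map_add, AddMemClass.coe_add]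
      ring
    change O.valuation (((x + y : O) : K) - algebraMap F K (g x + g y)) < 1
    rw [h]
    exact O.valuation.map_add_lt (hg x) (hg y)
  · intro c
    exact key (by simp)

section RationalPoints

variable {F : Type u} [Field F] {C : Scheme.{u}}

/-- The inclusion of the constants into a local ring of an `F`-scheme. -/
noncomputable def stalkConstants (s : C ⟶ Spec (CommRingCat.of F)) (x : C) :
    F →+* C.presheaf.stalk x :=
  ((Scheme.ΓSpecIso (CommRingCat.of F)).inv ≫ s.appTop ≫ C.presheaf.germ ⊤ x trivial).hom

/-- Turns compatibility of morphisms with the base Spec F into equalities of ring homomorphisms out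
of F. -/
theorem fromSpecStalk_comp (s : C ⟶ Spec (CommRingCat.of F)) (x : C) :
    C.fromSpecStalk x ≫ s = Spec.map (CommRingCat.ofHom (stalkConstants s x)) := by
  have h := Scheme.toSpecΓ_naturality s
  rw [← SpecMap_ΓSpecIso_hom] at h
  have h2 : s = C.toSpecΓ ≫ Spec.map s.appTop ≫
      Spec.map (Scheme.ΓSpecIso (CommRingCat.of F)).inv := by
    rw [← reassoc_of% h, ← Spec.map_comp]
    simp
  conv_lhs => rw [h2]
  rw [Scheme.fromSpecStalk_toSpecΓ_assoc, ← Spec.map_comp, ← Spec.map_comp]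
  rfl

theorem stalkClosedPointTo_comp_stalkConstants (s : C ⟶ Spec (CommRingCat.of F)) {R : Type u}
    [CommRing R] [IsLocalRing R] (g : Spec (CommRingCat.of R) ⟶ C) (h : F →+* R)
    (hg : g ≫ s = Spec.map (CommRingCat.ofHom h)) :
    (Scheme.stalkClosedPointTo g).hom.comp
      (stalkConstants s (g (IsLocalRing.closedPoint R))) = h := by
  have h1 := Scheme.Spec_stalkClosedPointTo_fromSpecStalk g
  rw [← h1, Category.assoc, fromSpecStalk_comp, ← Spec.map_comp] at hg
  have h2 := Spec.map_injective hg
  exact congrArg CommRingCat.Hom.hom h2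

variable [AlgebraicGeometry.IsIntegral C] (s : C ⟶ Spec (CommRingCat.of F))

theorem algebraMap_stalkConstants (x : C) (c : F) :
    algebraMap (C.presheaf.stalk x) C.functionField (stalkConstants s x c) = constants s c := by
  have h := C.presheaf.germ_stalkSpecializes (U := ⊤) (y := x) trivial
    ((genericPoint_spec C).specializes trivial)
  have h2 := congrArg (fun k => ((Scheme.ΓSpecIso (CommRingCat.of F)).inv ≫ s.appTop ≫ k).hom c) h
  exact h2

/-- The function field of an `F`-scheme as an extension of `F`. -/
@[reducible]
noncomputable def functionFieldAlgebra : Algebra F C.functionField := (constants s).toAlgebra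

variable [∀ x : C, ValuationRing (C.presheaf.stalk x)]

variable (C) in
/-- The local ring at a point, as a valuation subring of the function field. -/
noncomputable def stalkValuationSubring (x : C) : ValuationSubring C.functionField :=
  rangeValuationSubring (C.presheaf.stalk x) C.functionField

/-- The residue of a germ t is its value under p: the difference of t and this constant is killed by
the evaluation at p, so it is not a unit. -/
theorem isRationalPlace_of_rationalPoint (p : RationalPoints s) :
    let := functionFieldAlgebra s
    IsRationalPlace F (stalkValuationSubring C (p.1 (IsLocalRing.closedPoint F))) ∧
    ∀ t : C.presheaf.stalk (p.1 (IsLocalRing.closedPoint F)),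
      (stalkValuationSubring C (p.1 (IsLocalRing.closedPoint F))).valuation
        (algebraMap _ C.functionField t -
          constants s ((Scheme.stalkClosedPointTo p.1).hom t)) < 1 := by
  intro _
  have hr := stalkClosedPointTo_comp_stalkConstants s p.1 (RingHom.id F) (by
    rw [p.2]; exact (Spec.map_id _).symm)
  have key : ∀ t : C.presheaf.stalk (p.1 (IsLocalRing.closedPoint F)),
      (stalkValuationSubring C (p.1 (IsLocalRing.closedPoint F))).valuation
        (algebraMap _ C.functionField t -
          constants s ((Scheme.stalkClosedPointTo p.1).hom t)) < 1 := by
    intro t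
    rw [← algebraMap_stalkConstants s (p.1 (IsLocalRing.closedPoint F)), ← map_sub]
    refine valuation_rangeValuationSubring_lt_one fun hu => ?_
    have h1 := hu.map (Scheme.stalkClosedPointTo p.1).hom
    rw [map_sub] at h1
    have h2 := RingHom.congr_fun hr ((Scheme.stalkClosedPointTo p.1).hom t)
    rw [RingHom.comp_apply, RingHom.id_apply] at h2
    rw [h2, sub_self] at h1
    exact not_isUnit_zero h1
  refine ⟨⟨fun c => ⟨stalkConstants s _ c, algebraMap_stalkConstants s _ c⟩, ?_⟩, key⟩
  rintro _ ⟨t, rfl⟩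
  exact ⟨_, key t⟩

end RationalPoints

theorem existsUnique_lift_of_isProper {X Y : Scheme.{u}} (f : X ⟶ Y) [IsProper f] (R K : Type u)
    [CommRing R] [IsDomain R] [ValuationRing R] [Field K] [Algebra R K] [IsFractionRing R K]
    (i₁ : Spec (CommRingCat.of K) ⟶ X) (i₂ : Spec (CommRingCat.of R) ⟶ Y)
    (h : i₁ ≫ f = Spec.map (CommRingCat.ofHom (algebraMap R K)) ≫ i₂) :
    ∃! l : Spec (CommRingCat.of R) ⟶ X,
      Spec.map (CommRingCat.ofHom (algebraMap R K)) ≫ l = i₁ ∧ l ≫ f = i₂ := by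
  have hf : ValuativeCriterion f := by
    have : IsProper f := inferInstance
    rw [IsProper.eq_valuativeCriterion] at this
    exact this.1.1.1
  obtain ⟨u⟩ := hf ⟨R, K, i₁, i₂, ⟨h⟩⟩
  refine ⟨u.default.l, ⟨u.default.fac_left, u.default.fac_right⟩, fun l hl => ?_⟩
  exact congrArg CommSq.LiftStruct.l (u.uniq ⟨l, hl.1, hl.2⟩)

section RationalPoints

variable {F : Type u} [Field F] {C : Scheme.{u}} [AlgebraicGeometry.IsIntegral C]
  (s : C ⟶ Spec (CommRingCat.of F))

/-- The map from the spectrum of a valuation subring of the function field is the identity at the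
generic point. -/
def IsCenter (O : ValuationSubring C.functionField) (l : Spec (CommRingCat.of O) ⟶ C) : Prop :=
  Spec.map (CommRingCat.ofHom (algebraMap O C.functionField)) ≫ l =
    C.fromSpecStalk (genericPoint C)

/-- The inclusion of the constants into a valuation ring of the function field. -/
noncomputable def placeConstants (O : ValuationSubring C.functionField)
    (hO : ∀ c, constants s c ∈ O) : F →+* O :=
  (constants s).codRestrict O hO

theorem specMap_comp_specMap_placeConstants (O : ValuationSubring C.functionField)
    (hO : ∀ c, constants s c ∈ O) :
    C.fromSpecStalk (genericPoint C) ≫ s =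
      Spec.map (CommRingCat.ofHom (algebraMap O C.functionField)) ≫
        Spec.map (CommRingCat.ofHom (placeConstants s O hO)) := by
  rw [fromSpecStalk_comp, ← Spec.map_comp]
  rfl

theorem existsUnique_isCenter [IsProper s] (O : ValuationSubring C.functionField)
    (hO : ∀ c, constants s c ∈ O) :
    ∃! l : Spec (CommRingCat.of O) ⟶ C, IsCenter O l ∧
      l ≫ s = Spec.map (CommRingCat.ofHom (placeConstants s O hO)) := by
  exact existsUnique_lift_of_isProper s O C.functionField _ _
    (specMap_comp_specMap_placeConstants s O hO)

variable [∀ x : C, ValuationRing (C.presheaf.stalk x)]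

/-- O dominates the local ring at its centre, and a valuation ring is maximal for domination. -/
theorem stalkValuationSubring_eq_of_isCenter {O : ValuationSubring C.functionField}
    {l : Spec (CommRingCat.of O) ⟶ C} (hl : IsCenter O l) :
    stalkValuationSubring C (l (IsLocalRing.closedPoint O)) = O := by
  set x := l (IsLocalRing.closedPoint O) with hx
  have key : (algebraMap O C.functionField).comp (Scheme.stalkClosedPointTo l).hom =
      algebraMap (C.presheaf.stalk x) C.functionField := by
    have h1 : Spec.map (Scheme.stalkClosedPointTo l ≫
        CommRingCat.ofHom (algebraMap O C.functionField)) ≫ C.fromSpecStalk x =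
        Spec.map (C.presheaf.stalkSpecializes ((genericPoint_spec C).specializes trivial)) ≫
          C.fromSpecStalk x := by
      rw [Scheme.SpecMap_stalkSpecializes_fromSpecStalk, Spec.map_comp, Category.assoc,
        Scheme.Spec_stalkClosedPointTo_fromSpecStalk]
      exact hl
    rw [cancel_mono] at h1
    exact congrArg CommRingCat.Hom.hom (Spec.map_injective h1)
  refine le_antisymm ?_ fun y hy => ?_
  · rintro _ ⟨t, rfl⟩
    rw [← key]
    exact ((Scheme.stalkClosedPointTo l).hom t).2
  · by_contra hy'
    obtain ⟨t, ht⟩ := ((stalkValuationSubring C x).mem_or_inv_mem y).resolve_left hy'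
    have hy0 : y ≠ 0 := fun h0 => hy' (h0 ▸ zero_mem _)
    have hu : IsUnit ((Scheme.stalkClosedPointTo l).hom t) := by
      refine IsUnit.of_mul_eq_one (⟨y, hy⟩ : O) (Subtype.ext ?_)
      have h2 : (((Scheme.stalkClosedPointTo l).hom t : O) : C.functionField) = y⁻¹ :=
        (RingHom.congr_fun key t).trans ht
      change (((Scheme.stalkClosedPointTo l).hom t : O) : C.functionField) * y = 1
      rw [h2, inv_mul_cancel₀ hy0]
    have hut : IsUnit t := isUnit_of_map_unit (Scheme.stalkClosedPointTo l).hom t hu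
    obtain ⟨w, hw⟩ := hut.exists_right_inv
    refine hy' ⟨w, ?_⟩
    have h3 := congrArg (algebraMap (C.presheaf.stalk x) C.functionField) hw
    rw [map_mul, map_one] at h3
    have ht' : algebraMap (C.presheaf.stalk x) C.functionField t = y⁻¹ := ht
    rw [ht', inv_mul_eq_one₀ hy0] at h3
    exact h3.symm

theorem exists_isCenter_stalkValuationSubring (x : C) :
    ∃ j : C.presheaf.stalk x →+* stalkValuationSubring C x,
      (∀ t, (j t : C.functionField) = algebraMap _ C.functionField t) ∧
      IsCenter (stalkValuationSubring C x)
        (Spec.map (CommRingCat.ofHom j) ≫ C.fromSpecStalk x) := by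
  refine ⟨(algebraMap (C.presheaf.stalk x) C.functionField).codRestrict _ fun t => ⟨t, rfl⟩,
    fun t => rfl, ?_⟩
  rw [IsCenter, ← Spec.map_comp_assoc]
  exact Scheme.SpecMap_stalkSpecializes_fromSpecStalk
    ((genericPoint_spec C).specializes (Set.mem_univ x))

/-- Injectivity of the passage from points to places: l is forced by the uniqueness in the valuative
criterion, and r by the uniqueness of residues. -/
theorem rationalPoint_eq_of_stalkValuationSubring_eq [IsProper s]
    {O : ValuationSubring C.functionField} (p : RationalPoints s)
    (hp : stalkValuationSubring C (p.1 (IsLocalRing.closedPoint F)) = O)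
    (hO : @IsRationalPlace F C.functionField _ _ (functionFieldAlgebra s) O) {r : O →+* F}
    (hr : ∀ y : O, O.valuation (y - constants s (r y)) < 1)
    {l : Spec (CommRingCat.of O) ⟶ C} (hl : IsCenter O l)
    (hls : l ≫ s = Spec.map (CommRingCat.ofHom (placeConstants s O
      (let := functionFieldAlgebra s; hO.algebraMap_mem)))) :
    p.1 = Spec.map (CommRingCat.ofHom r) ≫ l := by
  let := functionFieldAlgebra s
  subst hp
  obtain ⟨j, hj, hjc⟩ := exists_isCenter_stalkValuationSubring (p.1 (IsLocalRing.closedPoint F))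
  have hjl : l = Spec.map (CommRingCat.ofHom j) ≫ C.fromSpecStalk _ := by
    refine (existsUnique_isCenter s _ hO.algebraMap_mem).unique ⟨hl, hls⟩ ⟨hjc, ?_⟩
    rw [Category.assoc, fromSpecStalk_comp, ← Spec.map_comp]
    congr 1
    ext c
    exact (hj _).trans (algebraMap_stalkConstants s _ c)
  rw [hjl, ← Spec.map_comp_assoc]
  conv_lhs => rw [← Scheme.Spec_stalkClosedPointTo_fromSpecStalk p.1]
  congr 2
  ext t
  refine hO.residue_unique ((isRationalPlace_of_rationalPoint s p).2 t) ?_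
  rw [← hj]
  exact hr (j t)

/-- A point gives its local ring. Conversely, properness gives a place O its centre Spec O ⟶ C, and
composing with the residue map O → F gives a rational point. -/
theorem card_rationalPoints [IsProper s] :
    Nat.card (RationalPoints s) =
      (@rationalPlaces F C.functionField _ _ (functionFieldAlgebra s)).ncard := by
  let := functionFieldAlgebra s
  rw [← Nat.card_coe_set_eq]
  refine Nat.card_eq_of_bijective (fun p =>
    ⟨stalkValuationSubring C (p.1 (IsLocalRing.closedPoint F)),
      (isRationalPlace_of_rationalPoint s p).1⟩) ⟨fun p p' h => ?_, ?_⟩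
  · have h' := congrArg Subtype.val h
    have hO := (isRationalPlace_of_rationalPoint s p').1
    obtain ⟨r, -, hr⟩ := hO.exists_residueHom
    obtain ⟨l, ⟨hl, hls⟩, -⟩ := existsUnique_isCenter s _ hO.algebraMap_mem
    apply Subtype.ext
    rw [rationalPoint_eq_of_stalkValuationSubring_eq s p h' hO hr hl hls,
      rationalPoint_eq_of_stalkValuationSubring_eq s p' rfl hO hr hl hls]
  · rintro ⟨O, hO : IsRationalPlace F O⟩
    obtain ⟨r, hrc, hr⟩ := hO.exists_residueHom
    obtain ⟨l, ⟨hl, hls⟩, -⟩ := existsUnique_isCenter s _ hO.algebraMap_mem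
    refine ⟨⟨Spec.map (CommRingCat.ofHom r) ≫ l, ?_⟩, Subtype.ext ?_⟩
    · rw [Category.assoc, hls, ← Spec.map_comp, ← Spec.map_id]
      congr 1
      ext c
      exact hrc c
    -- Locality of the residue map ensures that the point constructed is the centre of O.
    · have hloc : IsLocalHom r := by
        refine ⟨fun y hy => ?_⟩
        by_contra hny
        have h1 : O.valuation y < 1 := (O.valuation_lt_one_iff y).1 hny
        have h2 : r y = 0 := hO.residue_unique (hr y) (by simpa using h1)
        rw [h2] at hy
        exact not_isUnit_zero hy
      have hpt : (Spec.map (CommRingCat.ofHom r) ≫ l) (IsLocalRing.closedPoint F) =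
          l (IsLocalRing.closedPoint O) := by
        have : IsLocalHom (CommRingCat.ofHom r).hom := hloc
        exact (Scheme.Hom.comp_apply _ _ _).trans
          (congrArg l (Spec_closedPoint (f := CommRingCat.ofHom r)))
      change stalkValuationSubring C
        ((Spec.map (CommRingCat.ofHom r) ≫ l) (IsLocalRing.closedPoint F)) = O
      rw [hpt]
      exact stalkValuationSubring_eq_of_isCenter hl

end RationalPoints

/-! ### Extending morphisms from the generic point of a curve -/

section Extension

variable {C Y S : Scheme.{u}} [AlgebraicGeometry.IsIntegral C]

theorem isDominant_fromSpecStalk_genericPoint :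
    IsDominant (C.fromSpecStalk (genericPoint C)) := by
  refine ⟨?_⟩
  rw [DenseRange, dense_iff_closure_eq, Set.eq_univ_iff_forall]
  intro x
  have h : genericPoint C ∈ Set.range (C.fromSpecStalk (genericPoint C)) :=
    ⟨_, Scheme.fromSpecStalk_closedPoint⟩
  refine closure_mono (Set.singleton_subset_iff.2 h) ?_
  rw [genericPoint_closure]
  trivial

/-- At each x the valuative criterion for the valuation ring of x extends f to Spec of that local
ring, and such a morphism spreads out to a neighbourhood. Hence the rational map defined by f has
domain all of C. -/
theorem exists_hom_of_fromFunctionField [∀ x : C, ValuationRing (C.presheaf.stalk x)]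
    (sC : C ⟶ S) (sY : Y ⟶ S) [IsProper sY] [Y.IsSeparated] [S.IsSeparated]
    (f : Spec C.functionField ⟶ Y) (hf : f ≫ sY = C.fromSpecStalk (genericPoint C) ≫ sC) :
    ∃ φ : C ⟶ Y, φ ≫ sY = sC ∧ C.fromSpecStalk (genericPoint C) ≫ φ = f := by
  have hspec : ∀ x : C, genericPoint C ⤳ x := fun x =>
    (genericPoint_spec C).specializes (Set.mem_univ x)
  let r := Scheme.RationalMap.ofFunctionField sC sY f hf
  have hr : r.fromFunctionField = f := Scheme.RationalMap.fromFunctionField_ofFunctionField ..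
  have hdom : r.domain = ⊤ := by
    rw [eq_top_iff]
    intro x _
    rw [Scheme.RationalMap.mem_domain]
    have key := existsUnique_lift_of_isProper sY (C.presheaf.stalk x) C.functionField f
    obtain ⟨l, ⟨h1, h2⟩, -⟩ := key (C.fromSpecStalk x ≫ sC) (by
      rw [hf, ← Scheme.SpecMap_stalkSpecializes_fromSpecStalk (hspec x), Category.assoc]
      rfl)
    replace h1 : Spec.map (C.presheaf.stalkSpecializes (hspec x)) ≫ l = f := h1
    have hx := Scheme.PartialMap.mem_domain_ofFromSpecStalk sC sY l h2
    refine ⟨Scheme.PartialMap.ofFromSpecStalk sC sY l h2, hx, ?_⟩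
    refine Scheme.RationalMap.eq_of_fromFunctionField_eq _ _ ?_
    rw [hr, Scheme.RationalMap.fromFunctionField_toRationalMap, Scheme.PartialMap.fromFunctionField,
      Scheme.PartialMap.fromSpecStalkOfMem, ← h1]
    conv_rhs => rw [← Scheme.PartialMap.fromSpecStalkOfMem_ofFromSpecStalk sC sY l h2]
    rw [Scheme.PartialMap.fromSpecStalkOfMem, ← Category.assoc]
    congr 1
    rw [← cancel_mono (Scheme.Opens.ι _), Category.assoc, Scheme.Opens.fromSpecStalkOfMem_ι,
      Scheme.Opens.fromSpecStalkOfMem_ι, Scheme.SpecMap_stalkSpecializes_fromSpecStalk]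
  have hdom' : r.toPartialMap.domain = ⊤ := hdom
  have hfun : r.toPartialMap.fromFunctionField = f := by
    rw [← Scheme.RationalMap.fromFunctionField_toRationalMap,
      Scheme.RationalMap.toRationalMap_toPartialMap, hr]
  generalize r.toPartialMap = P at hdom' hfun
  obtain ⟨U, hU, g⟩ := P
  obtain rfl : U = ⊤ := hdom'
  have hφ : C.fromSpecStalk (genericPoint C) ≫ C.topIso.inv ≫ g = f := by
    rw [← hfun, Scheme.PartialMap.fromFunctionField, Scheme.PartialMap.fromSpecStalkOfMem,
      ← Category.assoc]
    congr 1
    rw [← cancel_mono (Scheme.Opens.ι _), Scheme.Opens.fromSpecStalkOfMem_ι, Category.assoc]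
    exact (congrArg _ C.topIso.inv_hom_id).trans (Category.comp_id _)
  refine ⟨C.topIso.inv ≫ g, ?_, hφ⟩
  -- Morphisms from an integral scheme to a separated one that agree at the generic point are equal.
  have := isDominant_fromSpecStalk_genericPoint (C := C)
  refine ext_of_isDominant (ι := C.fromSpecStalk (genericPoint C)) ?_
  rw [← hf, ← hφ]
  simp only [Category.assoc]

end Extension

/-! ### The standard charts of the projective line -/

section HomogeneousCoordinates

theorem isHomogeneous_eval₂_mul {R S σ : Type*} [CommSemiring R] [CommSemiring S] [Fintype σ]
    {p : MvPolynomial σ R} {n : ℕ} (hp : p.IsHomogeneous n) (f : R →+* S) (u : S) (v : σ → S) :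
    p.eval₂ f (fun j => u * v j) = u ^ n * p.eval₂ f v := by
  rw [MvPolynomial.eval₂_eq', MvPolynomial.eval₂_eq', Finset.mul_sum]
  refine Finset.sum_congr rfl fun d hd => ?_
  have hdeg : ∑ i, d i = n := by
    have h := hp (MvPolynomial.mem_support_iff.1 hd)
    rw [← h, ← Finsupp.degree_eq_sum, Finsupp.degree_eq_weight_one]
    rfl
  simp_rw [mul_pow]
  rw [Finset.prod_mul_distrib, Finset.prod_pow_eq_pow_sum, hdeg]
  ring

end HomogeneousCoordinates

section Charts

attribute [local instance] MvPolynomial.gradedAlgebra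

variable (F : Type u) [Field F]

/-- The grading of `F[X₀, X₁]` by degree. -/
noncomputable abbrev grading : ℕ → Submodule F (MvPolynomial (Fin 2) F) :=
  MvPolynomial.homogeneousSubmodule (Fin 2) F

variable {F}

theorem X_mem_grading (i : Fin 2) : (MvPolynomial.X i : MvPolynomial (Fin 2) F) ∈ grading F 1 :=
  MvPolynomial.isHomogeneous_X F i

/-- The coordinate ring of the chart `X i ≠ 0` of the projective line. -/
abbrev ChartRing (F : Type u) [Field F] (i : Fin 2) : Type u :=
  HomogeneousLocalization.Away (grading F) (MvPolynomial.X i)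

/-- The inclusion of constants into the coordinate ring of a chart. -/
noncomputable def chartConstants (i : Fin 2) : F →+* ChartRing F i :=
  (HomogeneousLocalization.fromZeroRingHom (grading F) _).comp (algebraMap F (grading F 0))

/-- The affine coordinate on a chart of the projective line. -/
noncomputable def chartCoordinate (i : Fin 2) : ChartRing F i :=
  HomogeneousLocalization.Away.mk (grading F) (X_mem_grading i) 1 (MvPolynomial.X (1 - i))
    (by rw [one_smul]; exact X_mem_grading _)

/-- The identification of a chart of the projective line with the affine line. -/
noncomputable def chart (i : Fin 2) : F[X] →+* ChartRing F i :=
  eval₂RingHom (chartConstants i) (chartCoordinate i)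

theorem chart_C (i : Fin 2) (c : F) : chart i (C c) = chartConstants i c :=
  eval₂_C _ _

theorem chart_X (i : Fin 2) : chart (F := F) i X = chartCoordinate i :=
  eval₂_X _ _

theorem val_chartConstants (i : Fin 2) (c : F) :
    (chartConstants i c).val = algebraMap (MvPolynomial (Fin 2) F)
      (Localization.Away (MvPolynomial.X i)) (MvPolynomial.C c) :=
  rfl

theorem val_chartCoordinate (i : Fin 2) :
    (chartCoordinate (F := F) i).val = Localization.mk (MvPolynomial.X (1 - i))
      (⟨MvPolynomial.X i ^ 1, 1, rfl⟩ : Submonoid.powers (MvPolynomial.X i)) :=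
  HomogeneousLocalization.Away.val_mk ..

/-- Dehomogenization: for x homogeneous of degree n, x / X_i ^ n is x evaluated at the quotients X_j
/ X_i, one of which is 1 and the other the coordinate. -/
theorem chart_surjective (i : Fin 2) : Function.Surjective (chart (F := F) i) := by
  intro z
  obtain ⟨n, x, hx, rfl⟩ := HomogeneousLocalization.Away.mk_surjective (grading F)
    (X_mem_grading i) z
  rw [smul_eq_mul, mul_one] at hx
  let A := MvPolynomial (Fin 2) F
  let L := Localization.Away (MvPolynomial.X i : A)
  let s : Submonoid.powers (MvPolynomial.X i : A) := ⟨MvPolynomial.X i ^ 1, 1, rfl⟩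
  let u : L := Localization.mk 1 s
  let val : ChartRing F i →+* L := algebraMap _ _
  have hval : ∀ z, val z = z.val := fun z => rfl
  let σ : Fin 2 → F[X] := fun j => if j = i then 1 else X
  refine ⟨x.eval₂ C σ, HomogeneousLocalization.val_injective _ ?_⟩
  have hσ : ∀ j, val (chart i (σ j)) = u * algebraMap A L (MvPolynomial.X j) := by
    intro j
    rw [← Localization.mk_one_eq_algebraMap, Localization.mk_mul, one_mul, mul_one]
    by_cases hj : j = i
    · subst hj
      rw [show σ j = 1 from if_pos rfl, map_one, map_one]
      rw [← Localization.mk_self s]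
      simp only [s, pow_one]
    · have hji : 1 - i = j := by clear * - hj; decide +revert
      rw [show σ j = X from if_neg hj, chart_X, hval, val_chartCoordinate, hji]
  have h1 : val (chart i (x.eval₂ C σ)) =
      x.eval₂ ((algebraMap A L).comp MvPolynomial.C)
        (fun j => u * algebraMap A L (MvPolynomial.X j)) := by
    rw [← RingHom.comp_apply, MvPolynomial.hom_eval₂]
    have hC : (val.comp (chart i)).comp C = (algebraMap A L).comp MvPolynomial.C := by
      ext c
      exact (congrArg val (chart_C i c)).trans (val_chartConstants i c)
    rw [hC]
    congr 1
    funext j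
    exact hσ j
  have h2 : x.eval₂ ((algebraMap A L).comp MvPolynomial.C)
      (fun j => algebraMap A L (MvPolynomial.X j)) = algebraMap A L x := by
    have := MvPolynomial.hom_eval₂ x (MvPolynomial.C (σ := Fin 2) (R := F)) (algebraMap A L)
      MvPolynomial.X
    rw [MvPolynomial.eval₂_eta] at this
    exact this.symm
  rw [← hval, h1, isHomogeneous_eval₂_mul hx, h2, HomogeneousLocalization.Away.val_mk,
    ← Localization.mk_one_eq_algebraMap, Localization.mk_pow, Localization.mk_mul, one_pow, one_mul,
    mul_one]
  congr 1
  exact Subtype.ext (congrArg (· ^ n) (pow_one (MvPolynomial.X i : A)))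

/-- The point of a chart with a given coordinate in an extension of `F`. -/
theorem exists_chartRing_ringHom {K : Type*} [Field K] [Algebra F K] (i : Fin 2) (a : K) :
    ∃ ψ : ChartRing F i →+* K, ∀ p, ψ (chart i p) = aeval a p := by
  let g : MvPolynomial (Fin 2) F →+* K :=
    MvPolynomial.eval₂Hom (algebraMap F K) fun j => if j = i then 1 else a
  have hg : IsUnit (g (MvPolynomial.X i)) := by simp [g]
  let ψ : ChartRing F i →+* K := (Localization.awayLift g _ hg).comp (algebraMap _ _)
  have hne : 1 - i ≠ i := by clear * -; decide +revert
  have h : ψ.comp (chart i) = (aeval a : F[X] →ₐ[F] K).toRingHom := by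
    refine Polynomial.ringHom_ext (fun c => ?_) ?_
    · rw [RingHom.comp_apply, chart_C]
      change Localization.awayLift g _ hg (chartConstants i c).val = aeval a (C c)
      rw [val_chartConstants, aeval_C]
      refine (IsLocalization.Away.lift_eq _ hg _).trans ?_
      simp [g]
    · rw [RingHom.comp_apply, chart_X]
      change Localization.awayLift g _ hg (chartCoordinate i).val = aeval a X
      rw [val_chartCoordinate, aeval_X]
      refine (Localization.awayLift_mk g (MvPolynomial.X i) (MvPolynomial.X (1 - i)) 1
        (by simp [g]) 1).trans ?_
      simp [g, hne]
  exact ⟨ψ, fun p => RingHom.congr_fun h p⟩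

end Charts

/-- Identifies the immersion of a chart built from graded localization with the one built from
sections, so that germs of sections can be compared with `awayι`. -/
theorem specMap_awayToSection_awayι {σ A : Type*} [CommRing A] [SetLike σ A]
    [AddSubgroupClass σ A] (𝒜 : ℕ → σ) [GradedRing 𝒜] {f : A} {m : ℕ} (hf : f ∈ 𝒜 m)
    (hm : 0 < m) :
    Spec.map (Proj.awayToSection 𝒜 f) ≫ Proj.awayι 𝒜 f hf hm =
      (Proj.isAffineOpen_basicOpen 𝒜 f hf hm).fromSpec := by
  rw [← cancel_epi (Proj.isAffineOpen_basicOpen 𝒜 f hf hm).isoSpec.hom,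
    IsAffineOpen.isoSpec_hom_fromSpec, IsAffineOpen.isoSpec_hom, Proj.awayι, ← Category.assoc]
  have h := Proj.basicOpenIsoSpec_hom 𝒜 f hf hm
  rw [Proj.basicOpenToSpec] at h
  rw [← h, Iso.hom_inv_id_assoc]

section ProjectiveLine

attribute [local instance] MvPolynomial.gradedAlgebra

variable (F : Type u) [Field F]

theorem adjoin_range_X_eq_top :
    Algebra.adjoin (grading F 0) (Set.range (MvPolynomial.X : Fin 2 → MvPolynomial (Fin 2) F)) =
      ⊤ := by
  rw [eq_top_iff]
  intro p _
  have h : p ∈ Algebra.adjoin F (Set.range (MvPolynomial.X : Fin 2 → MvPolynomial (Fin 2) F)) := by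
    rw [MvPolynomial.adjoin_range_X]
    trivial
  induction h using Algebra.adjoin_induction with
  | mem x hx => exact Algebra.subset_adjoin hx
  | algebraMap c => exact (Algebra.adjoin (grading F 0) _).algebraMap_mem (algebraMap F _ c)
  | add x y _ _ hx hy => exact add_mem (hx trivial) (hy trivial)
  | mul x y _ _ hx hy => exact mul_mem (hx trivial) (hy trivial)

theorem algebraMap_grading_zero_bijective : Function.Bijective (algebraMap F (grading F 0)) := by
  refine ⟨fun a b h => MvPolynomial.C_injective (Fin 2) F (congrArg Subtype.val h),
    fun x => ?_⟩
  obtain ⟨x, hx⟩ := x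
  have hx' : x ∈ (1 : Submodule F (MvPolynomial (Fin 2) F)) := by
    rw [← MvPolynomial.homogeneousSubmodule_zero]
    exact hx
  obtain ⟨c, rfl⟩ := Submodule.mem_one.1 hx'
  exact ⟨c, rfl⟩

instance isProper_toSpec : IsProper (ProjectiveLine.toSpec F) := by
  have : Algebra.FiniteType (grading F 0) (MvPolynomial (Fin 2) F) :=
    ⟨⟨(Set.finite_range MvPolynomial.X).toFinset, by
      rw [Set.Finite.coe_toFinset, adjoin_range_X_eq_top]⟩⟩
  have : IsIso (CommRingCat.ofHom (algebraMap F (grading F 0))) :=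
    (ConcreteCategory.isIso_iff_bijective _).2 (algebraMap_grading_zero_bijective F)
  have hproper : IsProper (Proj.toSpecZero (grading F)) := inferInstance
  exact MorphismProperty.comp_mem _ _ _ hproper inferInstance

instance isSeparated_projectiveLine : (ProjectiveLine F).IsSeparated :=
  inferInstanceAs (Scheme.IsSeparated (Proj (grading F)))

/-- The chart `X i ≠ 0` of the projective line. -/
noncomputable def chartOpen (i : Fin 2) : (ProjectiveLine F).Opens :=
  Proj.basicOpen (grading F) (MvPolynomial.X i)

theorem isAffineOpen_chartOpen (i : Fin 2) : IsAffineOpen (chartOpen F i) :=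
  Proj.isAffineOpen_basicOpen (grading F) _ (X_mem_grading i) one_pos

variable {F}

theorem exists_mem_chartOpen (y : ProjectiveLine F) : ∃ i, y ∈ chartOpen F i := by
  have h := Proj.iSup_basicOpen_eq_top' (grading F) MvPolynomial.X
    (fun i => ⟨1, X_mem_grading i⟩) (adjoin_range_X_eq_top F)
  have hy : y ∈ ⨆ i, Proj.basicOpen (grading F) (MvPolynomial.X i) := by
    rw [h]
    trivial
  exact TopologicalSpace.Opens.mem_iSup.1 hy

/-- The sections of the structure sheaf over a chart of the projective line. -/
noncomputable def chartSection (i : Fin 2) :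
    CommRingCat.of (ChartRing F i) ⟶ Γ(ProjectiveLine F, chartOpen F i) :=
  Proj.awayToSection (grading F) (MvPolynomial.X i)

instance isIso_chartSection (i : Fin 2) : IsIso (chartSection (F := F) i) :=
  inferInstanceAs (IsIso (Proj.basicOpenIsoAway (grading F) _ (X_mem_grading i) one_pos).hom)

/-- The inclusion of a chart into the projective line. -/
noncomputable def chartι (i : Fin 2) : Spec (CommRingCat.of (ChartRing F i)) ⟶ ProjectiveLine F :=
  Proj.awayι (grading F) _ (X_mem_grading i) one_pos

instance mono_chartι (i : Fin 2) : Mono (chartι (F := F) i) :=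
  inferInstanceAs (Mono (Proj.awayι (grading F) _ (X_mem_grading i) one_pos))

theorem chartι_mem_chartOpen (i : Fin 2) (z : Spec (CommRingCat.of (ChartRing F i))) :
    chartι i z ∈ chartOpen F i := by
  have h := Proj.opensRange_awayι (grading F) _ (X_mem_grading (F := F) i) one_pos
  have hz : chartι i z ∈ (Proj.awayι (grading F) _ (X_mem_grading (F := F) i) one_pos).opensRange :=
    ⟨z, rfl⟩
  rw [h] at hz
  exact hz

theorem specMap_chartSection_chartι (i : Fin 2) :
    Spec.map (chartSection i) ≫ chartι i = (isAffineOpen_chartOpen F i).fromSpec :=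
  specMap_awayToSection_awayι (grading F) (X_mem_grading i) one_pos

theorem chartι_toSpec (i : Fin 2) :
    chartι i ≫ ProjectiveLine.toSpec F = Spec.map (CommRingCat.ofHom (chartConstants i)) := by
  have h := Proj.awayι_toSpecZero (grading F) _ (X_mem_grading (F := F) i) one_pos
  have h1 : Proj.awayι (grading F) _ (X_mem_grading (F := F) i) one_pos ≫
      Proj.toSpecZero (grading F) ≫
        Spec.map (CommRingCat.ofHom (algebraMap F (grading F 0))) =
      Spec.map (CommRingCat.ofHom (chartConstants i)) := by
    rw [← Category.assoc, h, ← Spec.map_comp]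
    rfl
  exact h1

/-- The ring of polynomials in the affine coordinate of a chart maps to the local rings of the
projective line at points of this chart. -/
noncomputable def chartGerm (i : Fin 2) (y : ProjectiveLine F) (hy : y ∈ chartOpen F i) :
    F[X] →+* (ProjectiveLine F).presheaf.stalk y :=
  (chartSection i ≫ (ProjectiveLine F).presheaf.germ _ y hy).hom.comp (chart i)

theorem specMap_chartSection_germ_chartι (i : Fin 2) (y : ProjectiveLine F)
    (hy : y ∈ chartOpen F i) :
    Spec.map (chartSection i ≫ (ProjectiveLine F).presheaf.germ _ y hy) ≫ chartι i =
      (ProjectiveLine F).fromSpecStalk y := by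
  rw [Spec.map_comp, Category.assoc, specMap_chartSection_chartι]
  exact (isAffineOpen_chartOpen F i).fromSpecStalk_eq_fromSpecStalk hy

theorem chartGerm_C (i : Fin 2) (y : ProjectiveLine F) (hy : y ∈ chartOpen F i) (c : F) :
    chartGerm i y hy (C c) = stalkConstants (ProjectiveLine.toSpec F) y c := by
  have h := fromSpecStalk_comp (ProjectiveLine.toSpec F) y
  rw [← specMap_chartSection_germ_chartι i y hy, Category.assoc, chartι_toSpec,
    ← Spec.map_comp] at h
  have h1 := congrArg (fun k => k.hom c) (Spec.map_injective h)
  rw [chartGerm, RingHom.comp_apply, chart_C]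
  exact h1

theorem chartSection_comp_chart_surjective (i : Fin 2) :
    Function.Surjective ((chartSection i).hom.comp (chart (F := F) i)) :=
  ((ConcreteCategory.isIso_iff_bijective (chartSection i)).1 inferInstance).2.comp
    (chart_surjective i)

/-- The local ring is a localization of the chart ring, which is a quotient of F[X]; its elements
are therefore fractions of polynomials in the coordinate. -/
theorem exists_chartGerm_mul_eq (i : Fin 2) (y : ProjectiveLine F) (hy : y ∈ chartOpen F i)
    (t : (ProjectiveLine F).presheaf.stalk y) :
    ∃ a b, IsUnit (chartGerm i y hy b) ∧ t * chartGerm i y hy b = chartGerm i y hy a := by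
  let := (ProjectiveLine F).presheaf.algebra_section_stalk (⟨y, hy⟩ : chartOpen F i)
  have := (isAffineOpen_chartOpen F i).isLocalization_stalk ⟨y, hy⟩
  obtain ⟨⟨a, b⟩, hab⟩ := IsLocalization.surj
    ((isAffineOpen_chartOpen F i).primeIdealOf ⟨y, hy⟩).asIdeal.primeCompl t
  have hb := IsLocalization.map_units ((ProjectiveLine F).presheaf.stalk y) b
  obtain ⟨p, hp⟩ := chartSection_comp_chart_surjective i a
  obtain ⟨r, hr⟩ := chartSection_comp_chart_surjective i (b : Γ(ProjectiveLine F, chartOpen F i))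
  have hp' : chartGerm i y hy p = algebraMap _ _ a := by rw [← hp]; rfl
  have hr' : chartGerm i y hy r = algebraMap _ _ (b : Γ(ProjectiveLine F, chartOpen F i)) := by
    rw [← hr]; rfl
  exact ⟨p, r, hr' ▸ hb, by rw [hp', hr']; exact hab⟩

/-- A point of a chart is determined by its prime ideal, that is, by which polynomials are not units
in its local ring. -/
theorem eq_of_isUnit_chartGerm_iff (i : Fin 2) {y z : ProjectiveLine F} (hy : y ∈ chartOpen F i)
    (hz : z ∈ chartOpen F i)
    (h : ∀ p, IsUnit (chartGerm i y hy p) ↔ IsUnit (chartGerm i z hz p)) : y = z := by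
  have key : ∀ (w : ProjectiveLine F) (hw : w ∈ chartOpen F i) (p : F[X]),
      IsUnit (chartGerm i w hw p) ↔ (chartSection i).hom.comp (chart i) p ∉
        ((isAffineOpen_chartOpen F i).primeIdealOf ⟨w, hw⟩).asIdeal := by
    intro w hw p
    let := (ProjectiveLine F).presheaf.algebra_section_stalk (⟨w, hw⟩ : chartOpen F i)
    have := (isAffineOpen_chartOpen F i).isLocalization_stalk ⟨w, hw⟩
    exact IsLocalization.AtPrime.isUnit_to_map_iff ((ProjectiveLine F).presheaf.stalk w)
      ((isAffineOpen_chartOpen F i).primeIdealOf ⟨w, hw⟩).asIdeal _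
  have hprime : (isAffineOpen_chartOpen F i).primeIdealOf ⟨y, hy⟩ =
      (isAffineOpen_chartOpen F i).primeIdealOf ⟨z, hz⟩ := by
    refine PrimeSpectrum.ext (Ideal.ext fun f => ?_)
    obtain ⟨p, rfl⟩ := chartSection_comp_chart_surjective i f
    have := h p
    rwa [key, key, not_iff_not] at this
  have h1 := (isAffineOpen_chartOpen F i).fromSpec_primeIdealOf ⟨y, hy⟩
  rw [hprime, IsAffineOpen.fromSpec_primeIdealOf] at h1
  exact h1.symm

theorem stalkSpecializes_chartGerm (i : Fin 2) {y z : ProjectiveLine F} (h : y ⤳ z)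
    (hy : y ∈ chartOpen F i) (hz : z ∈ chartOpen F i) (p : F[X]) :
    ((ProjectiveLine F).presheaf.stalkSpecializes h).hom (chartGerm i z hz p) =
      chartGerm i y hy p := by
  have := (ProjectiveLine F).presheaf.germ_stalkSpecializes hz h
  exact congrArg (fun k => (chartSection i ≫ k).hom (chart i p)) this

end ProjectiveLine

/-! ### Morphisms from a curve to the projective line -/

section MorphismsToProjectiveLine

attribute [local instance] MvPolynomial.gradedAlgebra

variable {F : Type u} [Field F] {C : Scheme.{u}}

theorem stalkMap_stalkConstants {Y : Scheme.{u}} {s : C ⟶ Spec (CommRingCat.of F)}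
    {t : Y ⟶ Spec (CommRingCat.of F)} {φ : C ⟶ Y} (hφ : φ ≫ t = s) (x : C) (c : F) :
    (φ.stalkMap x).hom (stalkConstants t (φ x) c) = stalkConstants s x c := by
  have h := fromSpecStalk_comp s x
  rw [← hφ, ← Category.assoc, ← Scheme.SpecMap_stalkMap_fromSpecStalk, Category.assoc,
    fromSpecStalk_comp, ← Spec.map_comp, hφ] at h
  exact congrArg (fun k => k.hom c) (Spec.map_injective h)

variable [AlgebraicGeometry.IsIntegral C] {s : C ⟶ Spec (CommRingCat.of F)}
  {φ : C ⟶ ProjectiveLine F}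

theorem stalkMap_chartGerm (hφ : φ ≫ ProjectiveLine.toSpec F = s) {i : Fin 2}
    (hy : φ (genericPoint C) ∈ chartOpen F i) (p : F[X]) :
    let := functionFieldAlgebra s
    (φ.stalkMap (genericPoint C)).hom (chartGerm i _ hy p) =
      aeval ((φ.stalkMap (genericPoint C)).hom (chartGerm i _ hy X) : C.functionField) p := by
  intro _
  have h : (φ.stalkMap (genericPoint C)).hom.comp (chartGerm i _ hy) =
      (aeval ((φ.stalkMap (genericPoint C)).hom (chartGerm i _ hy X) : C.functionField) :
        F[X] →ₐ[F] C.functionField).toRingHom := by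
    refine Polynomial.ringHom_ext (fun c => ?_) ?_
    · rw [RingHom.comp_apply, chartGerm_C, stalkMap_stalkConstants hφ]
      exact (aeval_C _ c).symm
    · exact (aeval_X _).symm
  exact RingHom.congr_fun h p

theorem isUnit_chartGerm_iff (hφ : φ ≫ ProjectiveLine.toSpec F = s) {i : Fin 2}
    (hy : φ (genericPoint C) ∈ chartOpen F i) (p : F[X]) :
    let := functionFieldAlgebra s
    IsUnit (chartGerm i _ hy p) ↔
      aeval ((φ.stalkMap (genericPoint C)).hom (chartGerm i _ hy X) : C.functionField) p ≠ 0 := by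
  intro _
  rw [← stalkMap_chartGerm hφ hy, ← isUnit_iff_ne_zero]
  exact (isUnit_map_iff (φ.stalkMap (genericPoint C)).hom _).symm

/-- As θ is transcendental, every nonzero polynomial in the coordinate is a unit at the image of the
generic point, so the local ring there maps isomorphically onto F(θ). -/
theorem degree_eq_finrank (hφ : φ ≫ ProjectiveLine.toSpec F = s) {i : Fin 2}
    (hy : φ (genericPoint C) ∈ chartOpen F i) {θ : C.functionField}
    (hθ : θ = (φ.stalkMap (genericPoint C)).hom (chartGerm i _ hy X))
    (htrans : let := functionFieldAlgebra s; Transcendental F θ) :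
    let := functionFieldAlgebra s
    degree φ = Module.finrank (IntermediateField.adjoin F {θ}) C.functionField := by
  intro _
  set ρ : (ProjectiveLine F).presheaf.stalk (φ (genericPoint C)) →+* C.functionField :=
    (φ.stalkMap (genericPoint C)).hom with hρ
  have hρp : ∀ p, ρ (chartGerm i _ hy p) = aeval θ p := by
    rw [hθ]
    exact stalkMap_chartGerm hφ hy
  have hunit : ∀ p, p ≠ 0 → IsUnit (chartGerm i _ hy p) := by
    intro p hp
    refine (isUnit_chartGerm_iff hφ hy p).2 ?_
    rw [← hθ]
    exact fun h => hp ((transcendental_iff.1 htrans) p h)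
  have hinj : Function.Injective ρ := by
    rw [injective_iff_map_eq_zero]
    intro t ht
    obtain ⟨a, b, hb, hab⟩ := exists_chartGerm_mul_eq i _ hy t
    have h1 : aeval θ a = 0 := by rw [← hρp, ← hab, map_mul, ht, zero_mul]
    have h2 : a = 0 := (transcendental_iff.1 htrans) a h1
    rw [h2, map_zero] at hab
    exact (hb.mul_left_eq_zero).1 hab
  have hmem : ∀ t, ρ t ∈ IntermediateField.adjoin F {θ} := by
    intro t
    obtain ⟨a, b, hb, hab⟩ := exists_chartGerm_mul_eq i _ hy t
    have hb0 : aeval θ b ≠ 0 := by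
      rw [← hρp]
      exact (hb.map ρ).ne_zero
    rw [IntermediateField.mem_adjoin_simple_iff]
    refine ⟨a, b, ?_⟩
    rw [eq_div_iff hb0, ← hρp, ← hρp, ← map_mul, hab]
  have hbij : Function.Bijective (ρ.codRestrict (IntermediateField.adjoin F {θ}) hmem) := by
    refine ⟨fun a b h => hinj (congrArg Subtype.val h), fun x => ?_⟩
    obtain ⟨a, b, hab⟩ := IntermediateField.mem_adjoin_simple_iff F _ |>.1 x.2
    by_cases hb : b = 0
    · refine ⟨0, Subtype.ext ?_⟩
      rw [hab, hb, map_zero, map_zero, div_zero]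
      rfl
    · obtain ⟨c, hc⟩ := (hunit b hb).exists_right_inv
      refine ⟨chartGerm i _ hy a * c, Subtype.ext ?_⟩
      have h1 : ρ (chartGerm i _ hy a * c) = x := by
        have h2 := congrArg ρ hc
        rw [map_mul, map_one, hρp] at h2
        rw [map_mul, hρp, hab, div_eq_mul_inv, eq_inv_of_mul_eq_one_right h2]
      exact h1
  let := ρ.toAlgebra
  exact Algebra.finrank_eq_of_equiv_equiv (RingEquiv.ofBijective _ hbij)
    (RingEquiv.refl C.functionField) (by ext; rfl)

/-- The function θ is the pulled back coordinate of a chart that contains some φ x different from φ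
η, where η is the generic point. Were θ algebraic, the prime of φ η in F[X] would be nonzero, hence
maximal, hence equal to the prime of its specialization φ x. -/
theorem exists_transcendental_degree_eq (hφ : φ ≫ ProjectiveLine.toSpec F = s)
    (hconst : IsNonconstant φ) :
    let := functionFieldAlgebra s
    ∃ θ : C.functionField, Transcendental F θ ∧
      degree φ = Module.finrank (IntermediateField.adjoin F {θ}) C.functionField := by
  intro _
  obtain ⟨x, hx⟩ : ∃ x, φ x ≠ φ (genericPoint C) := by
    obtain ⟨x, y, hxy⟩ := hconst
    by_contra! h
    exact hxy ((h x).trans (h y).symm)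
  obtain ⟨i, hi⟩ := exists_mem_chartOpen (φ x)
  have hspec : φ (genericPoint C) ⤳ φ x :=
    ((genericPoint_spec C).specializes (Set.mem_univ x)).map φ.continuous
  have hy : φ (genericPoint C) ∈ chartOpen F i := hspec.mem_open (chartOpen F i).2 hi
  have htrans : Transcendental F
      ((φ.stalkMap (genericPoint C)).hom (chartGerm i _ hy X) : C.functionField) := by
    rintro ⟨p, hp0, hp⟩
    let I (y : ProjectiveLine F) (hy : y ∈ chartOpen F i) : Ideal F[X] :=
      (IsLocalRing.maximalIdeal _).comap (chartGerm i y hy)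
    have hI : ∀ y hy r, r ∈ I y hy ↔ ¬ IsUnit (chartGerm i y hy r) := fun y hy r =>
      (IsLocalRing.mem_maximalIdeal _)
    have hle : I _ hy ≤ I _ hi := by
      intro r hr
      rw [hI] at hr ⊢
      intro hu
      refine hr ?_
      rw [← stalkSpecializes_chartGerm i hspec hy hi]
      exact hu.map _
    have hpI : p ∈ I _ hy := by
      rw [hI]
      exact fun hu => (isUnit_chartGerm_iff hφ hy p).1 hu hp
    have hprime : (I _ hy).IsPrime := Ideal.comap_isPrime _ _
    have hmax : (I _ hy).IsMaximal :=
      IsPrime.to_maximal_ideal fun h => hp0 ((Submodule.mem_bot F[X]).1 (h ▸ hpI))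
    have hprime' : (I _ hi).IsPrime := Ideal.comap_isPrime _ _
    have heq := hmax.eq_of_le hprime'.ne_top hle
    refine hx (eq_of_isUnit_chartGerm_iff i hi hy fun r => ?_)
    rw [← not_iff_not, ← hI, ← hI, heq]
  exact ⟨_, htrans, degree_eq_finrank hφ hy rfl htrans⟩

/-- A transcendental function on a curve with a rational point is the coordinate of a nonconstant
morphism to the projective line. -/
theorem exists_isNonconstant_degree_eq [∀ x : C, ValuationRing (C.presheaf.stalk x)]
    (s : C ⟶ Spec (CommRingCat.of F)) (p : RationalPoints s) (θ : C.functionField)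
    (hθ : let := functionFieldAlgebra s; Transcendental F θ) :
    let := functionFieldAlgebra s
    ∃ φ : C ⟶ ProjectiveLine F, φ ≫ ProjectiveLine.toSpec F = s ∧ IsNonconstant φ ∧
      degree φ = Module.finrank (IntermediateField.adjoin F {θ}) C.functionField := by
  intro _
  obtain ⟨ψ, hψ⟩ : ∃ ψ : CommRingCat.of (ChartRing F 0) ⟶ C.functionField,
      ∀ p, ψ.hom (chart 0 p) = aeval θ p := by
    obtain ⟨ψ, hψ⟩ := exists_chartRing_ringHom (F := F) 0 θ
    exact ⟨CommRingCat.ofHom ψ, hψ⟩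
  let g : Spec C.functionField ⟶ ProjectiveLine F := Spec.map ψ ≫ chartι 0
  have hg : g ≫ ProjectiveLine.toSpec F = C.fromSpecStalk (genericPoint C) ≫ s := by
    rw [fromSpecStalk_comp, Category.assoc, chartι_toSpec, ← Spec.map_comp]
    congr 1
    ext c
    have h1 := hψ (Polynomial.C c)
    rw [chart_C, aeval_C] at h1
    exact h1
  obtain ⟨φ, hφ, hφg⟩ := exists_hom_of_fromFunctionField s (ProjectiveLine.toSpec F) g hg
  have hy : φ (genericPoint C) ∈ chartOpen F 0 := by
    have h1 : φ (C.fromSpecStalk (genericPoint C)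
        (IsLocalRing.closedPoint (C.presheaf.stalk (genericPoint C)))) =
        chartι 0 (Spec.map ψ (IsLocalRing.closedPoint (C.presheaf.stalk (genericPoint C)))) :=
      congrArg (fun k : Spec C.functionField ⟶ ProjectiveLine F =>
        k (IsLocalRing.closedPoint (C.presheaf.stalk (genericPoint C)))) hφg
    rw [Scheme.fromSpecStalk_closedPoint] at h1
    rw [h1]
    exact chartι_mem_chartOpen 0 _
  have hρ : chartSection 0 ≫ (ProjectiveLine F).presheaf.germ _ _ hy ≫
      φ.stalkMap (genericPoint C) = ψ := by
    refine Spec.map_injective ?_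
    rw [← cancel_mono (chartι 0)]
    refine Eq.trans ?_ hφg
    rw [← Scheme.SpecMap_stalkMap_fromSpecStalk, ← specMap_chartSection_germ_chartι 0 _ hy,
      ← Category.assoc, ← Category.assoc, ← Spec.map_comp]
  have hθ' : θ = (φ.stalkMap (genericPoint C)).hom (chartGerm 0 _ hy X) := by
    have h1 := hψ X
    rw [aeval_X] at h1
    rw [← h1]
    exact (congrArg (fun k => k.hom (chart 0 X)) hρ).symm
  refine ⟨φ, hφ, ⟨genericPoint C, p.1 (IsLocalRing.closedPoint F), fun hconst => ?_⟩,
    degree_eq_finrank hφ hy hθ' hθ⟩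
  set x := p.1 (IsLocalRing.closedPoint F) with hx
  have hyx : φ x ∈ chartOpen F 0 := hconst ▸ hy
  let κ : (ProjectiveLine F).presheaf.stalk (φ x) →+* F :=
    (Scheme.stalkClosedPointTo p.1).hom.comp (φ.stalkMap x).hom
  -- The coordinate minus its value at the rational point x is not a unit at φ x. It is a unit at
  -- the image of the generic point, since θ is not constant, so the two images differ.
  let r : F[X] := X - Polynomial.C (κ (chartGerm 0 _ hyx X))
  have hκ : κ (chartGerm 0 _ hyx r) = 0 := by
    have h1 := RingHom.congr_fun (stalkClosedPointTo_comp_stalkConstants s p.1 (RingHom.id F)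
      (by rw [p.2]; exact (Spec.map_id _).symm)) (κ (chartGerm 0 _ hyx X))
    rw [map_sub, map_sub, chartGerm_C, sub_eq_zero]
    refine Eq.trans ?_ (congrArg (Scheme.stalkClosedPointTo p.1).hom
      (stalkMap_stalkConstants hφ x _)).symm
    exact h1.symm
  have hunit : ∀ (y : ProjectiveLine F) (_ : φ (genericPoint C) = y) (h : y ∈ chartOpen F 0),
      IsUnit (chartGerm 0 y h r) := by
    rintro _ rfl h
    refine (isUnit_chartGerm_iff hφ h r).2 ?_
    rw [← hθ']
    exact fun h0 => X_sub_C_ne_zero _ ((transcendental_iff.1 hθ) r h0)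
  have := (hunit _ hconst hyx).map κ
  rw [hκ] at this
  exact not_isUnit_zero this

end MorphismsToProjectiveLine

/-! ### Transport along isomorphisms of function fields -/

section Transport

variable {F K L : Type*} [Field F] [Field K] [Field L] [Algebra F K] [Algebra F L]

/-- O and its pullback along an isomorphism have different value groups; a criterion by membership
alone can be transported. -/
theorem valuation_lt_one_iff_inv_notMem (O : ValuationSubring K) (x : K) :
    O.valuation x < 1 ↔ x = 0 ∨ x⁻¹ ∉ O := by
  by_cases hx : x = 0
  · simp [hx]
  · rw [← O.valuation_le_one_iff, map_inv₀,
      inv_le_one₀ (by rw [zero_lt_iff]; simpa using hx), not_le]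
    simp [hx]

theorem IsRationalPlace.comap {O : ValuationSubring L} (hO : IsRationalPlace F O)
    (e : K ≃ₐ[F] L) : IsRationalPlace F (O.comap (e : K →+* L)) := by
  refine ⟨fun c => ?_, fun x hx => ?_⟩
  · have h : e (algebraMap F K c) ∈ O := by
      rw [e.commutes]
      exact hO.algebraMap_mem c
    exact h
  · obtain ⟨c, hc⟩ := hO.exists_residue (e x) hx
    refine ⟨c, ?_⟩
    rw [valuation_lt_one_iff_inv_notMem] at hc ⊢
    rw [← e.commutes, ← map_sub, ← map_inv₀,
      map_eq_zero_iff e e.injective] at hc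
    exact hc

theorem ncard_rationalPlaces_congr (e : K ≃ₐ[F] L) :
    (rationalPlaces F K).ncard = (rationalPlaces F L).ncard := by
  refine Set.ncard_congr (fun O _ => O.comap (e.symm : L →+* K)) (fun O hO => ?_) ?_ ?_
  · exact IsRationalPlace.comap (K := L) hO e.symm
  · intro O O' _ _ h
    refine ValuationSubring.ext _ _ fun x => ?_
    have h1 := SetLike.ext_iff.1 h (e x)
    simpa [ValuationSubring.mem_comap] using h1
  · intro O hO
    refine ⟨O.comap (e : K →+* L), IsRationalPlace.comap hO e, ?_⟩
    refine ValuationSubring.ext _ _ fun x => ?_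
    simp [ValuationSubring.mem_comap]

theorem finrank_adjoin_simple_congr (e : K ≃ₐ[F] L) (a : K) :
    Module.finrank (IntermediateField.adjoin F {a}) K =
      Module.finrank (IntermediateField.adjoin F {e a}) L := by
  have h : (IntermediateField.adjoin F {a}).map (e : K →ₐ[F] L) =
      IntermediateField.adjoin F {e a} := by
    rw [IntermediateField.adjoin_map, Set.image_singleton]
    rfl
  refine Algebra.finrank_eq_of_equiv_equiv
    (((IntermediateField.adjoin F {a}).equivMap (e : K →ₐ[F] L)).trans
      (IntermediateField.equivOfEq h)).toRingEquiv e.toRingEquiv ?_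
  ext x
  rfl

end Transport

/-! ### Gonality and the main theorem. -/

/-- The gonality of a curve over a finite field that attains the bound
`ncard_rationalPlaces_le`. -/
theorem gonality_eq_finrank {F : Type u} [Field F] [Fintype F] {C : Scheme.{u}}
    [AlgebraicGeometry.IsIntegral C] (s : C ⟶ Spec (CommRingCat.of F)) [IsProper s]
    [SmoothOfRelativeDimension 1 s] (a : C.functionField)
    (ha : let := functionFieldAlgebra s; Transcendental F a)
    (hpos : 0 < Nat.card (RationalPoints s))
    (hcard : let := functionFieldAlgebra s; Nat.card (RationalPoints s) =
      Module.finrank (IntermediateField.adjoin F {a}) C.functionField * (Fintype.card F + 1)) :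
    let := functionFieldAlgebra s
    gonality s = Module.finrank (IntermediateField.adjoin F {a}) C.functionField := by
  intro _
  have hval : ∀ x : C, ValuationRing (C.presheaf.stalk x) := valuationRing_stalk s
  -- An infinite extension would have `finrank` 0, which a positive number of points excludes.
  have hfin : FiniteDimensional (IntermediateField.adjoin F {a}) C.functionField := by
    refine Module.finite_of_finrank_pos (Nat.pos_of_mul_pos_right (b := Fintype.card F + 1) ?_)
    rw [← hcard]
    exact hpos
  obtain ⟨⟨p⟩, -⟩ := Nat.card_pos_iff.1 hpos
  refine le_antisymm (Nat.sInf_le (exists_isNonconstant_degree_eq s p a ha)) ?_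
  -- Nonemptiness matters here, because the infimum of the empty set of naturals is 0.
  refine le_csInf ⟨_, exists_isNonconstant_degree_eq s p a ha⟩ ?_
  rintro n ⟨φ, hφ, hconst, rfl⟩
  obtain ⟨θ, hθ, hdeg⟩ := exists_transcendental_degree_eq hφ hconst
  rw [hdeg]
  -- The bound by degree times q + 1 applies to the competing function θ as well, so its degree is
  -- at least that of a.
  have := finiteDimensional_adjoin_of_transcendental a hθ
  refine Nat.le_of_mul_le_mul_right (c := Fintype.card F + 1) ?_ (Nat.succ_pos _)
  refine (hcard.symm.trans (card_rationalPoints s)).trans_le ?_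
  exact ncard_rationalPlaces_le hθ

end TAdic

/-- The curve C_α enters as any integral scheme, proper and smooth of relative dimension 1 over F,
with an isomorphism e of function fields; `he` makes e an isomorphism over F. -/
theorem theoremB {F : Type u} [Field F] [Fintype F]
    (α : AlgebraicClosure (RatFunc F))
    (hα : TAdic.IsTotallyTAdic α)
    (hnonconst : ¬ IsAlgebraic F α)
    (hheight : TAdic.height α = 1 / ((Fintype.card F : ℝ) + 1))
    (C : Scheme.{u}) [AlgebraicGeometry.IsIntegral C]
    (s : C ⟶ Spec (CommRingCat.of F)) [IsProper s] [SmoothOfRelativeDimension 1 s]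
    (e : C.functionField ≃+* IntermediateField.adjoin (RatFunc F) {α})
    (he : ∀ c : F, e (TAdic.constants s c) =
      algebraMap (RatFunc F) (IntermediateField.adjoin (RatFunc F) {α}) (RatFunc.C c)) :
    Nat.card (TAdic.RationalPoints s) =
        Module.finrank (RatFunc F) (IntermediateField.adjoin (RatFunc F) {α}) ∧
      Module.finrank (RatFunc F) (IntermediateField.adjoin (RatFunc F) {α}) =
        TAdic.gonality s * (Fintype.card F + 1) ∧
      TAdic.gonality s = (TAdic.positiveConjugates α).ncard := by
  obtain ⟨a, ha, -, hplaces, hdegree, hpos⟩ :=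
    TAdic.ncard_rationalPlaces_adjoin hα hnonconst hheight
  let := TAdic.functionFieldAlgebra s
  have hval : ∀ x : C, ValuationRing (C.presheaf.stalk x) := TAdic.valuationRing_stalk s
  let e' : C.functionField ≃ₐ[F] IntermediateField.adjoin (RatFunc F) {α} :=
    AlgEquiv.ofRingEquiv (f := e) he
  have hfr := TAdic.finrank_adjoin_simple_congr e' (e'.symm a)
  rw [e'.apply_symm_apply] at hfr
  have ha' : Transcendental F (e'.symm a) := by
    intro h
    have h1 := h.algHom (e' : C.functionField →ₐ[F] IntermediateField.adjoin (RatFunc F) {α})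
    exact ha (by simpa using h1)
  have hcard : Nat.card (TAdic.RationalPoints s) =
      Module.finrank (RatFunc F) (IntermediateField.adjoin (RatFunc F) {α}) := by
    rw [TAdic.card_rationalPoints s, TAdic.ncard_rationalPlaces_congr e', hplaces]
  have hint : IsIntegral (RatFunc F) α := Algebra.IsIntegral.isIntegral α
  have := IntermediateField.adjoin.finiteDimensional hint
  have hgon := TAdic.gonality_eq_finrank s (e'.symm a)
    ha' (by rw [hcard]; exact Module.finrank_pos)
    (by rw [hcard, hdegree, ← hfr])
  rw [hgon, hfr]
  exact ⟨hcard, hdegree, hpos⟩
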